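/- There is an absolute constant $C>0$ such that the following holds. Let $G=(V,E)$ be a connected (finite, simple, undirected) graph on $n$ vertices with positive real edge weights $w$, let $k\ge 1$ be an integer, let $\varepsilon>0$ be real, and put $t=(2k-1)(1+\varepsilon)$. Run the greedy algorithm with stretch parameter $t$: start with $H=(V,\emptyset)$, inspect the edges of $G$ one by one in any non-decreasing order of weight, and add the inspected edge $\{u,v\}$ to $H$ exactly when $d_H(u,v)>t\cdot w(u,v)$, where $d_H$ is the weighted shortest-path distance in the current $H$ ($\infty$ between different components). The final graph $H$ satisfies: 1. $H$ is a $t$-spanner of $G$: it is a subgraph of $G$, and $d_H(u,v)\le t\cdot d_G(u,v)$ for all $u,v\in V$. 2. $H$ has at most $C\,n^{1+1/k}$ edges, and in fact at most $C\,n^{1+1/m}$ edges, where $m=\lfloor\lceil t\rceil/2\rfloor\ge k$. 3. If $k\ge 2$, the lightness of $H$ satisfies $$\frac{w(H)}{w(MST(G))}\le C\, n^{1/k}\Bigl(1+\frac{k}{\varepsilon^{1+1/k}\,\log k}\Bigr),$$ where $w(H)$ is the total weight of the edges of $H$ and $MST(G)$ is a minimum spanning tree of $G$ (for $n=1$ the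 quotient $0/0$ is read as $0$). For $k=1$ the right-hand side is infinite, as $\log 1=0$, and nothing is claimed. -/

import Mathlib

namespace LightSpanner

universe u

/-- The shortest path distance `d_H(u, v)` for the edge weights `w`: the infimum of the total
weights of the walks of `H` from `u` to `v`; it is `∞` if `v` is not reachable from `u`. -/
noncomputable def wdist {V : Type u} (w : Sym2 V → ℝ) (H : SimpleGraph V) (x y : V) : ENNReal :=
  ⨅ p : H.Walk x y, ENNReal.ofReal (p.edges.map w).sum

/-- The total weight `w(H)` of the edges of `H`. -/
noncomputable def weight {V : Type u} [Fintype V] (w : Sym2 V → ℝ) (H : SimpleGraph V) : ℝ :=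
  open Classical in ∑ e ∈ H.edgeFinset, w e

/-- `H` is a `t`-spanner of `G`. -/
def IsSpanner {V : Type u} (G : SimpleGraph V) (w : Sym2 V → ℝ) (t : ℝ) (H : SimpleGraph V) :
    Prop :=
  H ≤ G ∧ ∀ x y : V, wdist w H x y ≤ ENNReal.ofReal t * wdist w G x y

/-- `Z` is a minimum spanning tree of `G`. -/
def IsMST {V : Type u} [Fintype V] (G : SimpleGraph V) (w : Sym2 V → ℝ) (Z : SimpleGraph V) :
    Prop :=
  Z ≤ G ∧ Z.IsTree ∧ ∀ T : SimpleGraph V, T ≤ G → T.IsTree → weight w Z ≤ weight w T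

/-- The lightness `w(H) / w(Z)` of `H`, where `Z` is a minimum spanning tree. -/
noncomputable def lightness {V : Type u} [Fintype V] (w : Sym2 V → ℝ) (H Z : SimpleGraph V) : ℝ :=
  weight w H / weight w Z

/-- The list `l` enumerates every edge of `G` exactly once, in non-decreasing order of weight
(ties are broken arbitrarily). -/
def IsEdgeOrder {V : Type u} (G : SimpleGraph V) (w : Sym2 V → ℝ) (l : List (Sym2 V)) : Prop :=
  l.Nodup ∧ (∀ e, e ∈ l ↔ e ∈ G.edgeSet) ∧ l.Pairwise (fun e f => w e ≤ w f)

/-- One step of the greedy algorithm: the edge `e = {x, y}` is added to the current graph `H`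
if and only if `d_H(x, y) > t * w(e)`. -/
noncomputable def greedyStep {V : Type u} (w : Sym2 V → ℝ) (t : ℝ) (H : SimpleGraph V)
    (e : Sym2 V) : SimpleGraph V :=
  open Classical in
  if ∃ x y : V, e = s(x, y) ∧ ENNReal.ofReal (t * w e) < wdist w H x y then
    H ⊔ SimpleGraph.fromEdgeSet {e}
  else H

/-- The output of the greedy algorithm with stretch parameter `t`, which starts from the graph
without edges and inspects the edges in the order of the list `l`. -/
noncomputable def greedy {V : Type u} (w : Sym2 V → ℝ) (t : ℝ) (l : List (Sym2 V)) :
    SimpleGraph V :=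
  l.foldl (greedyStep w t) ⊥

/-- Every finite weighted graph has an order in which the greedy algorithm can inspect its edges. -/
theorem exists_isEdgeOrder {V : Type u} [Fintype V] (G : SimpleGraph V) (w : Sym2 V → ℝ) :
    ∃ l, IsEdgeOrder G w l := by
  classical
  let r : Sym2 V → Sym2 V → Prop := fun e f => w e ≤ w f
  have : Std.Total r := ⟨fun a b => le_total (w a) (w b)⟩
  have : IsTrans (Sym2 V) r := ⟨fun _ _ _ h h' => le_trans h h'⟩
  refine ⟨G.edgeFinset.toList.insertionSort r, ?_, ?_, ?_⟩
  · exact (List.perm_insertionSort r _).nodup_iff.2 (Finset.nodup_toList _)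
  · intro e
    rw [(List.perm_insertionSort r _).mem_iff, Finset.mem_toList, SimpleGraph.mem_edgeFinset]
  · exact List.pairwise_insertionSort r _

end LightSpanner

/-! Everything about the size and weight of the greedy output `H` follows from one property,
`GreedyInvariant.not_within`: an edge `xy` of `H` has no detour of weight at most `t * w(xy)` in `H`
without `xy`.

Size: if a cycle of `H` has `ℓ` edges, its heaviest edge has a detour of weight at most `ℓ - 1`
times its own, so `ℓ > t + 1 ≥ 2m` (`lt_length_of_isCycle`), and the Moore bound
`card_edgeFinset_le_of_girth` applies.

Lightness: `H` contains a spanning tree `T` of weight `L` at most `M = w(MST)`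
(`exists_isTree_le_weight_le`). Edges lighter than `M / n` are paid for by the size bound. The other
non-tree edges are split into classes with weights in `[w₀, k w₀]`. An Euler tour of `T` places the
vertices in `[0, 2L]` so that tree distances are at most distances on the line, and the line is cut
into cells of length `ε w₀ / 2`. Each edge `e` yields `⌊w e / w₀⌋` parallel copies, the `i`-th one
joining the cells `i` places beyond those of its ends. Being off by at most `w e / w₀` cells costs
at most about `ε * w e / 2`, so a cycle with at most `2k` edges in this blow-up would give the
heaviest edge involved a detour of stretch `(2k-1)(1+ε)`. The blow-up thus has girth more than `2k`,
and the Moore bound limits the number of copies, which up to a factor 2 is the weight of the class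
divided by `w₀` (`sum_weight_le_of_not_within`).

For `w₀ = (M / n) k^j` the class bounds decay like `k^(-j/k)` and sum to `O(k / log k)` times the
first. Copying edges is what allows classes as wide as a factor `k`; classes of ratio 2 would give
`k` instead of `k / log k`. -/

namespace LightSpanner

universe u

variable {V : Type u} {w : Sym2 V → ℝ}

/-! ### Walks of bounded weight and weighted distances -/

/-- `H` contains a walk from `x` to `y` of total weight at most `r`. -/
def Within (w : Sym2 V → ℝ) (H : SimpleGraph V) (x y : V) (r : ℝ) : Prop :=
  ∃ p : H.Walk x y, (p.edges.map w).sum ≤ r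

theorem Within.refl (H : SimpleGraph V) (x : V) : Within w H x x 0 :=
  ⟨.nil, by simp⟩

theorem Within.trans {H : SimpleGraph V} {x y z : V} {r s : ℝ} (h : Within w H x y r)
    (h' : Within w H y z s) : Within w H x z (r + s) := by
  obtain ⟨p, hp⟩ := h
  obtain ⟨q, hq⟩ := h'
  refine ⟨p.append q, ?_⟩
  rw [SimpleGraph.Walk.edges_append, List.map_append, List.sum_append]
  linarith

theorem Within.symm {H : SimpleGraph V} {x y : V} {r : ℝ} (h : Within w H x y r) :
    Within w H y x r := by
  obtain ⟨p, hp⟩ := h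
  exact ⟨p.reverse, by rwa [SimpleGraph.Walk.edges_reverse, List.map_reverse, List.sum_reverse]⟩

theorem Within.le {H : SimpleGraph V} {x y : V} {r s : ℝ} (h : Within w H x y r) (hrs : r ≤ s) :
    Within w H x y s := by
  obtain ⟨p, hp⟩ := h
  exact ⟨p, hp.trans hrs⟩

theorem Within.mono {H K : SimpleGraph V} {x y : V} {r : ℝ} (h : Within w H x y r) (hHK : H ≤ K) :
    Within w K x y r := by
  obtain ⟨p, hp⟩ := h
  exact ⟨p.mapLe hHK, by rwa [SimpleGraph.Walk.edges_mapLe_eq_edges]⟩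

theorem Within.of_adj {H : SimpleGraph V} {x y : V} (h : H.Adj x y) : Within w H x y (w s(x, y)) :=
  ⟨h.toWalk, by simp⟩

theorem Within.nonneg {H : SimpleGraph V} {x y : V} {r : ℝ} (hw : ∀ e ∈ H.edgeSet, 0 ≤ w e)
    (h : Within w H x y r) : 0 ≤ r := by
  obtain ⟨p, hp⟩ := h
  refine le_trans (List.sum_nonneg ?_) hp
  intro a ha
  obtain ⟨e, he, rfl⟩ := List.mem_map.1 ha
  exact hw e (p.edges_subset_edgeSet he)

theorem Within.wdist_le {H : SimpleGraph V} {x y : V} {r : ℝ} (h : Within w H x y r) :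
    wdist w H x y ≤ ENNReal.ofReal r := by
  obtain ⟨p, hp⟩ := h
  exact (iInf_le _ p).trans (ENNReal.ofReal_le_ofReal hp)

theorem wdist_mono {H K : SimpleGraph V} (hHK : H ≤ K) (x y : V) :
    wdist w K x y ≤ wdist w H x y := by
  refine le_iInf fun p => (iInf_le _ (p.mapLe hHK)).trans ?_
  rw [SimpleGraph.Walk.edges_mapLe_eq_edges]

theorem wdist_comm (H : SimpleGraph V) (x y : V) : wdist w H x y = wdist w H y x := by
  have key : ∀ x y, wdist w H x y ≤ wdist w H y x := fun x y => by
    refine le_iInf fun p => (iInf_le _ p.reverse).trans ?_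
    rw [SimpleGraph.Walk.edges_reverse, List.map_reverse, List.sum_reverse]
  exact le_antisymm (key x y) (key y x)

theorem wdist_triangle (H : SimpleGraph V) (x y z : V) :
    wdist w H x z ≤ wdist w H x y + wdist w H y z := by
  unfold wdist
  rw [ENNReal.iInf_add]
  refine le_iInf fun p => ?_
  rw [ENNReal.add_iInf]
  refine le_iInf fun q => (iInf_le _ (p.append q)).trans ?_
  rw [SimpleGraph.Walk.edges_append, List.map_append, List.sum_append]
  exact ENNReal.ofReal_add_le

theorem reachable_of_wdist_ne_top {H : SimpleGraph V} {x y : V} (h : wdist w H x y ≠ ⊤) :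
    H.Reachable x y := by
  by_contra hr
  have : IsEmpty (H.Walk x y) := by
    rw [← not_nonempty_iff]; exact hr
  exact h (by simp [wdist])

/-- A walk in `K` with one more edge `f` either can be shortcut to a walk in `K`, or goes through
`f` after a walk in `K` and before a walk in `K`. -/
theorem Within.split_edge {K : SimpleGraph V} (hw : ∀ e ∈ K.edgeSet, 0 ≤ w e) {f : Sym2 V}
    (hf : 0 ≤ w f) {x y : V} {r : ℝ} (h : Within w (K ⊔ SimpleGraph.fromEdgeSet {f}) x y r) :
    Within w K x y r ∨ ∃ a b r₁ r₂, f = s(a, b) ∧ Within w K x a r₁ ∧ Within w K b y r₂ ∧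
      r₁ + w f + r₂ ≤ r := by
  obtain ⟨p, hp⟩ := h
  induction p generalizing r with
  | nil => exact .inl ⟨.nil, by simpa using hp⟩
  | @cons x z y hadj p ih =>
    rw [SimpleGraph.Walk.edges_cons, List.map_cons, List.sum_cons] at hp
    have ih' := ih (r := r - w s(x, z)) (by linarith)
    have hadj' : K.Adj x z ∨ s(x, z) = f := by
      rw [SimpleGraph.sup_adj, SimpleGraph.fromEdgeSet_adj] at hadj
      exact hadj.imp id fun h => by simpa using h.1
    rcases hadj' with hK | rfl
    · have h0 := hw s(x, z) hK
      rcases ih' with h1 | ⟨a, b, r₁, r₂, hab, h1, h2, h3⟩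
      · exact .inl (((Within.of_adj hK).trans h1).le (by linarith))
      · exact .inr ⟨a, b, w s(x, z) + r₁, r₂, hab, (Within.of_adj hK).trans h1, h2, by linarith⟩
    · rcases ih' with h1 | ⟨a, b, r₁, r₂, hab, h1, h2, h3⟩
      · exact .inr ⟨x, z, 0, _, rfl, .refl _ _, h1, by linarith⟩
      -- The walk crosses `f` twice. Same direction: drop everything between the crossings and one
      -- crossing. Opposite directions: drop the whole excursion.
      · have h1' := h1.nonneg hw
        rcases Sym2.eq_iff.1 hab with ⟨rfl, rfl⟩ | ⟨rfl, rfl⟩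
        · exact .inr ⟨x, z, 0, r₂, rfl, .refl _ _, h2, by linarith⟩
        · exact .inl (h2.le (by linarith))

/-! ### The greedy algorithm and its invariant -/

theorem greedy_append_singleton (t : ℝ) (l : List (Sym2 V)) (e : Sym2 V) :
    greedy w t (l ++ [e]) = greedyStep w t (greedy w t l) e := by
  simp [greedy, List.foldl_append]

theorem le_greedyStep (t : ℝ) (H : SimpleGraph V) (e : Sym2 V) : H ≤ greedyStep w t H e := by
  unfold greedyStep
  split_ifs
  · exact le_sup_left
  · exact le_rfl

theorem greedyStep_mk (t : ℝ) (H : SimpleGraph V) (a b : V) :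
    (ENNReal.ofReal (t * w s(a, b)) < wdist w H a b ∧
      greedyStep w t H s(a, b) = H ⊔ SimpleGraph.fromEdgeSet {s(a, b)}) ∨
    (wdist w H a b ≤ ENNReal.ofReal (t * w s(a, b)) ∧ greedyStep w t H s(a, b) = H) := by
  unfold greedyStep
  split_ifs with h
  · obtain ⟨x, y, hxy, h⟩ := h
    refine .inl ⟨?_, rfl⟩
    rcases Sym2.eq_iff.1 hxy with ⟨rfl, rfl⟩ | ⟨rfl, rfl⟩
    · exact h
    · rwa [wdist_comm]
  · exact .inr ⟨not_lt.1 fun h' => h ⟨a, b, rfl, h'⟩, rfl⟩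

/-- What the greedy algorithm guarantees after having inspected the edges of the list `l`. -/
structure GreedyInvariant (w : Sym2 V → ℝ) (t : ℝ) (l : List (Sym2 V)) (H : SimpleGraph V) :
    Prop where
  mem_of_mem_edgeSet : ∀ e ∈ H.edgeSet, e ∈ l
  wdist_le : ∀ x y, s(x, y) ∈ l → wdist w H x y ≤ ENNReal.ofReal (t * w s(x, y))
  exists_walk : ∀ x y, s(x, y) ∈ l → ∃ p : H.Walk x y, ∀ e ∈ p.edges, w e ≤ w s(x, y)
  not_within : ∀ x y, H.Adj x y →
    ¬ Within w (H.deleteEdges {s(x, y)}) x y (t * w s(x, y))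

/-- The last inspected edge is the heaviest so far. This makes walks in the old graph light enough
for `exists_walk`, and it lets a short detour of an older edge through the new edge be turned into a
short detour of the new edge. -/
theorem greedyInvariant {t : ℝ} (ht : 1 ≤ t) (l : List (Sym2 V)) (hnd : l.Nodup)
    (hpw : l.Pairwise fun e f => w e ≤ w f) (hpos : ∀ e ∈ l, 0 < w e)
    (hdiag : ∀ e ∈ l, ¬ e.IsDiag) : GreedyInvariant w t l (greedy w t l) := by
  induction l using List.reverseRecOn with
  | nil => exact ⟨by simp [greedy], by simp, by simp, by simp [greedy]⟩
  | append_singleton l f ih =>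
    rw [List.nodup_append] at hnd
    rw [List.pairwise_append] at hpw
    have hfl : f ∉ l := fun hf => hnd.2.2 f hf f (by simp) rfl
    have hle : ∀ e ∈ l, w e ≤ w f := fun e he => hpw.2.2 e he f (by simp)
    have hf0 : 0 < w f := hpos f (by simp)
    have inv := ih hnd.1 hpw.1 (fun e he => hpos e (by simp [he]))
      fun e he => hdiag e (by simp [he])
    have hfd := hdiag f (by simp)
    rw [greedy_append_singleton]
    set H := greedy w t l with hH
    have hHw : ∀ e ∈ H.edgeSet, 0 ≤ w e := fun e he =>
      (hpos e (by simp [inv.mem_of_mem_edgeSet e he])).le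
    have hmono : H ≤ greedyStep w t H f := le_greedyStep _ _ _
    obtain ⟨a, b⟩ := f
    change s(a, b) ∉ l at hfl
    change ∀ e ∈ l, w e ≤ w s(a, b) at hle
    change 0 < w s(a, b) at hf0
    change a ≠ b at hfd
    change H ≤ greedyStep w t H s(a, b) at hmono
    change GreedyInvariant w t (l ++ [s(a, b)]) (greedyStep w t H s(a, b))
    have hmem : ∀ e ∈ l ++ [s(a, b)], e ∈ l ∨ e = s(a, b) := fun e he => by simpa using he
    rcases greedyStep_mk (w := w) t H a b with ⟨hlt, heq⟩ | ⟨hge, heq⟩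
    · have hab : (greedyStep w t H s(a, b)).Adj a b := by rw [heq]; simp [hfd]
      have hba := hab.symm
      have hadj : ∀ x y, (greedyStep w t H s(a, b)).Adj x y → H.Adj x y ∨ s(x, y) = s(a, b) := by
        intro x y h
        rw [heq, SimpleGraph.sup_adj, SimpleGraph.fromEdgeSet_adj] at h
        exact h.imp id fun h => h.1
      have hwithin : ¬ Within w H a b (t * w s(a, b)) := fun h => hlt.not_ge h.wdist_le
      refine ⟨?_, ?_, ?_, ?_⟩
      · rintro ⟨x, y⟩ h
        rcases hadj x y h with h | h
        · exact List.mem_append_left _ (inv.mem_of_mem_edgeSet _ h)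
        · exact List.mem_append_right _ (by simpa using h)
      · intro x y hxy
        rcases hmem _ hxy with h | h
        · exact (wdist_mono hmono x y).trans (inv.wdist_le x y h)
        · have : (greedyStep w t H s(a, b)).Adj x y := by
            rcases Sym2.eq_iff.1 h with ⟨rfl, rfl⟩ | ⟨rfl, rfl⟩ <;> assumption
          refine ((Within.of_adj this).le ?_).wdist_le
          rw [h]
          nlinarith
      · intro x y hxy
        rcases hmem _ hxy with h | h
        · obtain ⟨p, hp⟩ := inv.exists_walk x y h
          exact ⟨p.mapLe hmono, by rwa [SimpleGraph.Walk.edges_mapLe_eq_edges]⟩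
        · have : (greedyStep w t H s(a, b)).Adj x y := by
            rcases Sym2.eq_iff.1 h with ⟨rfl, rfl⟩ | ⟨rfl, rfl⟩ <;> assumption
          exact ⟨this.toWalk, by simp⟩
      · intro x y hxy hW
        by_cases hne : s(x, y) = s(a, b)
        · have hle' : (greedyStep w t H s(a, b)).deleteEdges {s(x, y)} ≤ H := by
            intro c d hcd
            rw [SimpleGraph.deleteEdges_adj] at hcd
            rcases hadj c d hcd.1 with h | h
            · exact h
            · exact absurd (h.trans hne.symm) hcd.2
          have hW' := hW.mono hle'
          rw [hne] at hW'
          rcases Sym2.eq_iff.1 hne with ⟨rfl, rfl⟩ | ⟨rfl, rfl⟩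
          · exact hwithin hW'
          · exact hwithin hW'.symm
        · have hHxy : H.Adj x y := (hadj x y hxy).resolve_right hne
          have hle' : (greedyStep w t H s(a, b)).deleteEdges {s(x, y)} ≤
              H.deleteEdges {s(x, y)} ⊔ SimpleGraph.fromEdgeSet {s(a, b)} := by
            intro c d hcd
            rw [SimpleGraph.deleteEdges_adj] at hcd
            rw [SimpleGraph.sup_adj, SimpleGraph.deleteEdges_adj, SimpleGraph.fromEdgeSet_adj]
            exact (hadj c d hcd.1).imp (fun h => ⟨h, hcd.2⟩) fun h => ⟨h, hcd.1.ne⟩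
          have hKH : H.deleteEdges {s(x, y)} ≤ H := SimpleGraph.deleteEdges_le _
          have hlexy : w s(x, y) ≤ w s(a, b) := hle _ (inv.mem_of_mem_edgeSet _ hHxy)
          rcases (hW.mono hle').split_edge
            (fun e he => hHw e (SimpleGraph.edgeSet_mono hKH he)) hf0.le with
            h | ⟨c, d, r₁, r₂, hcd, h1, h2, h3⟩
          · exact inv.not_within x y hHxy h
          -- Exchange the two edges on the closed walk: the detour of the new edge weighs at most
          -- `r₁ + w(xy) + r₂ ≤ t * w(xy) + w(xy) - w(ab) ≤ t * w(ab)`.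
          · have h4 : Within w H c d (t * w s(a, b)) :=
              (((h1.mono hKH).symm.trans (Within.of_adj hHxy)).trans (h2.mono hKH).symm).le
                (by nlinarith)
            rcases Sym2.eq_iff.1 hcd with ⟨rfl, rfl⟩ | ⟨rfl, rfl⟩
            · exact hwithin h4
            · exact hwithin h4.symm
    · rw [heq]
      obtain ⟨p⟩ := reachable_of_wdist_ne_top (ne_top_of_le_ne_top ENNReal.ofReal_ne_top hge)
      refine ⟨fun e he => List.mem_append_left _ (inv.mem_of_mem_edgeSet e he), ?_, ?_,
        inv.not_within⟩
      · intro x y hxy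
        rcases hmem _ hxy with h | h
        · exact inv.wdist_le x y h
        · rw [h]
          rcases Sym2.eq_iff.1 h with ⟨rfl, rfl⟩ | ⟨rfl, rfl⟩
          · exact hge
          · rwa [wdist_comm]
      · intro x y hxy
        rcases hmem _ hxy with h | h
        · exact inv.exists_walk x y h
        · rw [h]
          have hp : ∀ e ∈ p.edges, w e ≤ w s(a, b) := fun e he =>
            hle e (inv.mem_of_mem_edgeSet e (p.edges_subset_edgeSet he))
          rcases Sym2.eq_iff.1 h with ⟨rfl, rfl⟩ | ⟨rfl, rfl⟩
          · exact ⟨p, hp⟩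
          · exact ⟨p.reverse, by simpa using hp⟩

theorem GreedyInvariant.isSpanner {G H : SimpleGraph V} {t : ℝ} {l : List (Sym2 V)}
    (inv : GreedyInvariant w t l H) (ht : 0 < t) (hl : ∀ e, e ∈ l ↔ e ∈ G.edgeSet)
    (hw : ∀ e ∈ G.edgeSet, 0 ≤ w e) : IsSpanner G w t H := by
  refine ⟨fun x y h => (hl s(x, y)).1 (inv.mem_of_mem_edgeSet s(x, y) h), fun x y => ?_⟩
  have key : ∀ {x y : V} (p : G.Walk x y),
      wdist w H x y ≤ ENNReal.ofReal t * ENNReal.ofReal (p.edges.map w).sum := by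
    intro x y p
    induction p with
    | nil => exact (Within.refl H _).wdist_le.trans (by simp)
    | @cons x z y h p ih =>
      have h0 : 0 ≤ (p.edges.map w).sum := Within.nonneg hw ⟨p, le_rfl⟩
      rw [SimpleGraph.Walk.edges_cons, List.map_cons, List.sum_cons,
        ENNReal.ofReal_add (hw _ h) h0, mul_add]
      refine (wdist_triangle H x z y).trans (add_le_add ?_ ih)
      rw [← ENNReal.ofReal_mul ht.le]
      exact inv.wdist_le x z ((hl _).2 h)
  conv_rhs => rw [wdist, ENNReal.mul_iInf_of_ne (by simpa using ht) ENNReal.ofReal_ne_top]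
  exact le_iInf key

/-! ### The Moore bound -/

section Moore

variable {α : Type u} {Γ : SimpleGraph α}

/-- Common first edges are stripped off. Where the paths part, the first edge of `p` together with
the rest of `p` and the reverse of `q` contains a cycle of length at most `N`. -/
theorem eq_of_isPath_of_length_add_le {N : ℕ}
    (hΓ : ∀ (v : α) (c : Γ.Walk v v), c.IsCycle → N < c.length) {x y : α} (p q : Γ.Walk x y)
    (hp : p.IsPath) (hq : q.IsPath) (hlen : p.length + q.length ≤ N) : p = q := by
  classical
  induction p with
  | nil => exact (SimpleGraph.Walk.isPath_iff_nil.1 hq).eq_nil.symm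
  | @cons x z y h p ih =>
    cases q with
    | nil => exact absurd (SimpleGraph.Walk.isPath_iff_nil.1 hp) (by simp)
    | @cons _ z' _ h' q =>
      rw [SimpleGraph.Walk.cons_isPath_iff] at hp hq
      simp only [SimpleGraph.Walk.length_cons] at hlen
      by_cases hz : z = z'
      · subst hz
        rw [ih q hp.1 hq.1 (by omega)]
      · exfalso
        have hr : s(x, z) ∉ (p.append (SimpleGraph.Walk.cons h' q).reverse).edges := by
          rw [SimpleGraph.Walk.edges_append, List.mem_append, SimpleGraph.Walk.edges_reverse,
            List.mem_reverse, SimpleGraph.Walk.edges_cons, List.mem_cons]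
          rintro (h1 | h1 | h1)
          · exact hp.2 (SimpleGraph.Walk.fst_mem_support_of_mem_edges _ h1)
          · rcases Sym2.eq_iff.1 h1 with ⟨-, h2⟩ | ⟨h2, -⟩
            · exact hz h2
            · exact h'.ne h2
          · exact hq.2 (SimpleGraph.Walk.fst_mem_support_of_mem_edges _ h1)
        have hc := SimpleGraph.Path.cons_isCycle
          (p.append (SimpleGraph.Walk.cons h' q).reverse).toPath h
          fun h1 => hr (SimpleGraph.Walk.edges_toPath_subset_edges _ h1)
        have h1 := hΓ _ _ hc
        have h2 := SimpleGraph.Walk.length_bypass_le_length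
          (p.append (SimpleGraph.Walk.cons h' q).reverse)
        simp only [SimpleGraph.Walk.length_cons, SimpleGraph.Walk.length_append,
          SimpleGraph.Walk.length_reverse, SimpleGraph.Walk.toPath] at h1 h2
        omega

/-- In a graph of girth more than `2m`, a vertex has at most one neighbour that is not further
away from `v` and at distance less than `m`. -/
theorem eq_of_adj_of_dist_le {m : ℕ}
    (hΓ : ∀ (v : α) (c : Γ.Walk v v), c.IsCycle → 2 * m < c.length) {v y z z' : α}
    (hy : Γ.Reachable v y) (hz : Γ.Adj z y) (hz' : Γ.Adj z' y) (hd : Γ.dist v z ≤ Γ.dist v y)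
    (hd' : Γ.dist v z' ≤ Γ.dist v y) (hm : Γ.dist v z < m) (hm' : Γ.dist v z' < m) : z = z' := by
  classical
  have key : ∀ z, Γ.Adj z y → Γ.dist v z ≤ Γ.dist v y → ∃ p : Γ.Walk v z,
      p.length = Γ.dist v z ∧ ∀ h : Γ.Adj z y, (p.concat h).IsPath := by
    intro z hz hd
    obtain ⟨p, hp⟩ := (hy.trans hz.symm.reachable).exists_walk_length_eq_dist
    refine ⟨p, hp, fun h => ?_⟩
    rw [SimpleGraph.Walk.concat_isPath_iff]
    refine ⟨p.isPath_of_length_eq_dist hp, fun hys => ?_⟩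
    have h1 := SimpleGraph.dist_le (p.takeUntil y hys)
    have h2 := congrArg SimpleGraph.Walk.length (p.take_spec hys)
    rw [SimpleGraph.Walk.length_append] at h2
    have h3 : (p.dropUntil y hys).length = 0 := by omega
    exact hz.ne (SimpleGraph.Walk.eq_of_length_eq_zero h3).symm
  obtain ⟨p, hp, hp'⟩ := key z hz hd
  obtain ⟨q, hq, hq'⟩ := key z' hz' hd'
  have := eq_of_isPath_of_length_add_le hΓ _ _ (hp' hz) (hq' hz') (by
    simp only [SimpleGraph.Walk.length_concat]; omega)
  have h2 := congrArg SimpleGraph.Walk.penultimate this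
  simpa using h2

/-- Spheres around a vertex grow by a factor `d` up to radius `m`: a vertex has at most one
neighbour outside the next sphere, and a vertex of that sphere has at most one neighbour in the
previous one. The growth follows by double counting. -/
theorem pow_le_card_of_le_degree [Fintype α] [Nonempty α] [DecidableRel Γ.Adj] {m d : ℕ}
    (hΓ : ∀ (v : α) (c : Γ.Walk v v), c.IsCycle → 2 * m < c.length)
    (hd : ∀ v, d + 1 ≤ Γ.degree v) : d ^ m ≤ Fintype.card α := by
  classical
  obtain ⟨v⟩ := ‹Nonempty α›
  let S : ℕ → Finset α := fun j => {x | Γ.Reachable v x ∧ Γ.dist v x = j}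
  have hS : ∀ j ≤ m, d ^ j ≤ (S j).card := by
    intro j
    induction j with
    | zero =>
      intro _
      rw [pow_zero, Nat.one_le_iff_ne_zero, Finset.card_ne_zero]
      exact ⟨v, by simp [S]⟩
    | succ j ih =>
      intro hj
      rw [pow_succ, ← mul_one (S (j + 1)).card]
      refine (Nat.mul_le_mul_right d (ih (by omega))).trans
        (Finset.card_mul_le_card_mul Γ.Adj ?_ ?_)
      · intro y hy
        obtain ⟨hy1, hy2⟩ : Γ.Reachable v y ∧ Γ.dist v y = j := by simpa [S] using hy
        have hone : (Γ.neighborFinset y \ (S (j + 1)).bipartiteAbove Γ.Adj y).card ≤ 1 := by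
          refine Finset.card_le_one.2 fun z hz z' hz' => ?_
          have aux : ∀ z ∈ Γ.neighborFinset y \ (S (j + 1)).bipartiteAbove Γ.Adj y,
              Γ.Adj z y ∧ Γ.dist v z ≤ Γ.dist v y := by
            intro z hz
            rw [Finset.mem_sdiff, SimpleGraph.mem_neighborFinset, Finset.mem_bipartiteAbove] at hz
            refine ⟨hz.1.symm, ?_⟩
            have h1 : Γ.dist v z ≤ Γ.dist v y + 1 := by
              obtain ⟨p, hp⟩ := hy1.exists_walk_length_eq_dist
              simpa [hp] using SimpleGraph.dist_le (p.concat hz.1)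
            have h2 : Γ.dist v z ≠ j + 1 := fun h =>
              hz.2 ⟨by simp [S, h, hy1.trans hz.1.reachable], hz.1⟩
            omega
          have h1 := aux z hz
          have h2 := aux z' hz'
          exact eq_of_adj_of_dist_le hΓ hy1 h1.1 h2.1 h1.2 h2.2 (by omega) (by omega)
        have h1 := Finset.le_card_sdiff ((S (j + 1)).bipartiteAbove Γ.Adj y) (Γ.neighborFinset y)
        have h2 := hd y
        rw [← SimpleGraph.card_neighborFinset_eq_degree] at h2
        omega
      · intro y hy
        obtain ⟨hy1, hy2⟩ : Γ.Reachable v y ∧ Γ.dist v y = j + 1 := by simpa [S] using hy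
        refine Finset.card_le_one.2 fun z hz z' hz' => ?_
        rw [Finset.mem_bipartiteBelow] at hz hz'
        have h1 : Γ.dist v z = j := by simpa [S] using (Finset.mem_filter.1 hz.1).2.2
        have h2 : Γ.dist v z' = j := by simpa [S] using (Finset.mem_filter.1 hz'.1).2.2
        exact eq_of_adj_of_dist_le hΓ hy1 hz.2 hz'.2 (by omega) (by omega) (by omega) (by omega)
  exact (hS m le_rfl).trans (Finset.card_le_univ _)

/-- A graph with more than `d` edges per vertex has a nonempty set of vertices that induces a
subgraph of minimum degree more than `d`. -/
theorem exists_induce_degree_of_card_lt [Fintype α] [DecidableEq α] [DecidableRel Γ.Adj] {d : ℕ}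
    (h : d * Fintype.card α < Γ.edgeFinset.card) :
    ∃ S : Finset α, S.Nonempty ∧ ∀ x ∈ S, d < (S.filter (Γ.Adj x)).card := by
  by_contra! hcon
  have key : ∀ (n : ℕ) (S : Finset α), S.card = n →
      ∑ x ∈ S, (S.filter (Γ.Adj x)).card ≤ 2 * d * S.card := by
    intro n
    induction n with
    | zero => intro S hS; rw [Finset.card_eq_zero] at hS; simp [hS]
    | succ n ih =>
      intro S hS
      obtain ⟨x, hx, hxd⟩ := hcon S (Finset.card_pos.1 (by omega))
      have hcard : (S.erase x).card = n := by rw [Finset.card_erase_of_mem hx]; omega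
      have h1 := ih (S.erase x) hcard
      rw [← Finset.add_sum_erase _ _ hx]
      have h2 : ∑ y ∈ S.erase x, (S.filter (Γ.Adj y)).card ≤
          ∑ y ∈ S.erase x, (((S.erase x).filter (Γ.Adj y)).card + if Γ.Adj x y then 1 else 0) := by
        refine Finset.sum_le_sum fun y hy => ?_
        rw [← Finset.insert_erase hx, Finset.filter_insert]
        simp only [Finset.insert_erase hx, Γ.adj_comm y x]
        split_ifs
        · exact Finset.card_insert_le _ _
        · simp
      rw [Finset.sum_add_distrib, Finset.sum_boole] at h2
      have h3 : ((S.erase x).filter (Γ.Adj x)).card ≤ (S.filter (Γ.Adj x)).card :=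
        Finset.card_le_card (Finset.filter_subset_filter _ (Finset.erase_subset _ _))
      rw [hcard] at h1
      rw [hS]
      simp only [Nat.cast_id] at h2
      nlinarith
  have h1 := key _ Finset.univ rfl
  have h2 := Γ.sum_degrees_eq_twice_card_edges
  have h3 : ∀ x, Γ.degree x = (Finset.univ.filter (Γ.Adj x)).card := fun x => by
    rw [← SimpleGraph.card_neighborFinset_eq_degree, SimpleGraph.neighborFinset_eq_filter]
  simp only [← h3] at h1
  rw [h2, Finset.card_univ] at h1
  nlinarith

/-- The Moore bound: a graph on `n` vertices without cycles of length at most `2m` has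
`O(n ^ (1 + 1 / m))` edges. -/
theorem card_edgeFinset_le_of_girth [Fintype α] [DecidableRel Γ.Adj] {m : ℕ} (hm : m ≠ 0)
    (hΓ : ∀ (v : α) (c : Γ.Walk v v), c.IsCycle → 2 * m < c.length) :
    (Γ.edgeFinset.card : ℝ) ≤ 2 * (Fintype.card α : ℝ) ^ (1 + 1 / (m : ℝ)) := by
  classical
  by_contra! hlt
  set n := Fintype.card α with hn
  have hn0 : 0 < n := by
    rw [hn, Fintype.card_pos_iff]
    by_contra hemp
    rw [not_nonempty_iff] at hemp
    have : Γ.edgeFinset = ∅ := by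
      ext e; exact Sym2.ind (fun a _ => hemp.elim a) e
    rw [this, Finset.card_empty, Nat.cast_zero] at hlt
    exact absurd hlt (not_lt.2 (by positivity))
  have hn1 : (1 : ℝ) ≤ n := by exact_mod_cast hn0
  have hroot : (1 : ℝ) ≤ (n : ℝ) ^ (1 / (m : ℝ)) := Real.one_le_rpow hn1 (by positivity)
  -- Large enough for `d ^ m > n`, small enough for `d * n` to stay below the assumed number of
  -- edges.
  set d := ⌊(n : ℝ) ^ (1 / (m : ℝ))⌋₊ + 1 with hd
  have hdlt : (n : ℝ) ^ (1 / (m : ℝ)) < d := by rw [hd]; exact_mod_cast Nat.lt_floor_add_one _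
  have hdle : (d : ℝ) ≤ 2 * (n : ℝ) ^ (1 / (m : ℝ)) := by
    rw [hd]; push_cast
    have := Nat.floor_le (zero_le_one.trans hroot)
    linarith
  have hcard : d * Fintype.card α < Γ.edgeFinset.card := by
    have : ((d * n : ℕ) : ℝ) < Γ.edgeFinset.card := by
      refine lt_of_le_of_lt ?_ hlt
      rw [Real.rpow_add (by positivity), Real.rpow_one]
      push_cast
      nlinarith
    exact_mod_cast this
  obtain ⟨S, ⟨x, hx⟩, hS⟩ := exists_induce_degree_of_card_lt hcard
  have : Nonempty (S : Set α) := ⟨⟨x, hx⟩⟩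
  have hpow := pow_le_card_of_le_degree (Γ := Γ.induce (S : Set α)) (m := m) (d := d)
    (fun v c hc => by
      have := hΓ _ _ (hc.map (f := (SimpleGraph.Embedding.induce (S : Set α)).toHom)
        Subtype.val_injective)
      rwa [SimpleGraph.Walk.length_map] at this)
    (fun v => by
      refine (hS v v.2).trans_eq ?_
      rw [← SimpleGraph.card_neighborFinset_eq_degree]
      refine (Finset.card_bij (fun y _ => y.1) ?_ ?_ ?_).symm
      · intro y hy
        simpa using hy
      · intro a _ b _ h; exact Subtype.ext h
      · intro b hb
        rw [Finset.mem_filter] at hb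
        exact ⟨⟨b, hb.1⟩, by simpa using hb.2, rfl⟩)
  have h1 : Fintype.card (S : Set α) ≤ n := Fintype.card_subtype_le _
  have h2 : (n : ℝ) < (d : ℝ) ^ m := by
    calc (n : ℝ) = ((n : ℝ) ^ (1 / (m : ℝ))) ^ m := by
          rw [← Real.rpow_natCast, ← Real.rpow_mul (by positivity),
            one_div_mul_cancel (by exact_mod_cast hm), Real.rpow_one]
      _ < (d : ℝ) ^ m := pow_lt_pow_left₀ hdlt (by positivity) hm
  have h3 : (d ^ m : ℕ) ≤ n := hpow.trans h1
  have h4 : ((d : ℝ) ^ m) ≤ n := by exact_mod_cast h3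
  linarith

end Moore

/-! ### A light spanning tree inside `H`, by edge exchange -/

theorem reachable_deleteEdges_or {T : SimpleGraph V} (a b : V) {x : V} (h : T.Reachable x a) :
    (T.deleteEdges {s(a, b)}).Reachable a x ∨ (T.deleteEdges {s(a, b)}).Reachable b x := by
  obtain ⟨p⟩ := h
  suffices ∀ {x y : V} (p : T.Walk x y), y = a →
      (T.deleteEdges {s(a, b)}).Reachable a x ∨ (T.deleteEdges {s(a, b)}).Reachable b x from
    this p rfl
  intro x y p hy
  induction p with
  | nil => exact .inl (by rw [hy])
  | @cons x z y h p ih =>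
    by_cases hxz : s(x, z) = s(a, b)
    · rcases Sym2.eq_iff.1 hxz with ⟨rfl, rfl⟩ | ⟨rfl, rfl⟩
      · exact .inl .rfl
      · exact .inr .rfl
    · have hadj : (T.deleteEdges {s(a, b)}).Adj z x :=
        ((SimpleGraph.deleteEdges_adj).2 ⟨h, hxz⟩).symm
      exact (ih hy).imp (·.trans hadj.reachable) (·.trans hadj.reachable)

theorem connected_exchange {T : SimpleGraph V} (hT : T.Connected) {a b c d : V}
    (hc : (T.deleteEdges {s(a, b)}).Reachable a c)
    (hd : (T.deleteEdges {s(a, b)}).Reachable b d) (hcd : c ≠ d) :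
    (T.deleteEdges {s(a, b)} ⊔ SimpleGraph.fromEdgeSet {s(c, d)}).Connected := by
  set K := T.deleteEdges {s(a, b)} ⊔ SimpleGraph.fromEdgeSet {s(c, d)} with hK
  have hle : T.deleteEdges {s(a, b)} ≤ K := le_sup_left
  have hadj : K.Adj c d := by rw [hK]; simp [hcd]
  have hab : K.Reachable a b :=
    ((hc.mono hle).trans hadj.reachable).trans (hd.mono hle).symm
  have hall : ∀ x, K.Reachable a x := fun x =>
    (reachable_deleteEdges_or a b (hT x a)).elim (·.mono hle) fun h => hab.trans (h.mono hle)
  have := hT.nonempty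
  exact ⟨fun x y => (hall x).symm.trans (hall y)⟩

theorem weight_eq_sum_filter [Fintype V] [Fintype (Sym2 V)] (H : SimpleGraph V)
    [DecidablePred (· ∈ H.edgeSet)] : weight w H = ∑ e with e ∈ H.edgeSet, w e := by
  unfold weight
  exact Finset.sum_congr (by ext; simp) fun _ _ => rfl

theorem weight_nonneg [Fintype V] {H : SimpleGraph V} (hw : ∀ e ∈ H.edgeSet, 0 ≤ w e) :
    0 ≤ weight w H := by
  classical
  rw [weight_eq_sum_filter]
  exact Finset.sum_nonneg fun e he => hw e (Finset.mem_filter.1 he).2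

/-- If the ends of every edge `e` of `G` are joined in `H` by edges that weigh at most `w e`, then
`H` contains a spanning tree that weighs at most as much as a given spanning tree of `G`. -/
theorem exists_isTree_le_weight_le [Fintype V] {G H Z : SimpleGraph V}
    (hH : ∀ x y, G.Adj x y → ∃ p : H.Walk x y, ∀ e ∈ p.edges, w e ≤ w s(x, y)) (hHG : H ≤ G)
    (hZG : Z ≤ G) (hZ : Z.IsTree) : ∃ T ≤ H, T.IsTree ∧ weight w T ≤ weight w Z := by
  classical
  suffices ∀ (n : ℕ) (T : SimpleGraph V), T ≤ G → T.IsTree →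
      (T.edgeSet \ H.edgeSet).ncard = n → ∃ T' ≤ H, T'.IsTree ∧ weight w T' ≤ weight w T from
    this _ Z hZG hZ rfl
  intro n
  induction n with
  | zero =>
    intro T hTG hT h0
    rw [Set.ncard_eq_zero (Set.toFinite _), Set.sdiff_eq_empty] at h0
    exact ⟨T, SimpleGraph.edgeSet_subset_edgeSet.1 h0, hT, le_rfl⟩
  | succ n ih =>
    intro T hTG hT hn
    obtain ⟨⟨a, b⟩, hf⟩ := (Set.ncard_pos (Set.toFinite _)).1 (by omega : 
      0 < (T.edgeSet \ H.edgeSet).ncard)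
    change s(a, b) ∈ _ at hf
    obtain ⟨hfT, hfH⟩ := hf
    have hbr : ¬ (T.deleteEdges {s(a, b)}).Reachable a b :=
      SimpleGraph.isBridge_iff.1 (SimpleGraph.isAcyclic_iff_forall_isBridge.1 hT.isAcyclic hfT)
    -- Deleting `ab` cuts `T` in two. The walk of `H` from `a` to `b` crosses the cut along some
    -- `cd` no heavier than `ab`, and `cd` replaces `ab`.
    obtain ⟨p, hp⟩ := hH a b (hTG hfT)
    obtain ⟨e, hep, hc, hd⟩ := p.exists_boundary_dart
      {x | (T.deleteEdges {s(a, b)}).Reachable a x} .rfl hbr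
    have hew := hp _ (List.mem_map_of_mem hep)
    obtain ⟨⟨c, d⟩, hcd⟩ := e
    change (T.deleteEdges {s(a, b)}).Reachable a c at hc
    change ¬ (T.deleteEdges {s(a, b)}).Reachable a d at hd
    change w s(c, d) ≤ w s(a, b) at hew
    change H.Adj c d at hcd
    have hd' := (reachable_deleteEdges_or a b (hT.connected d a)).resolve_left hd
    set K := T.deleteEdges {s(a, b)} ⊔ SimpleGraph.fromEdgeSet {s(c, d)} with hK
    have hgT : s(c, d) ∉ (T.deleteEdges {s(a, b)}).edgeSet := fun h =>
      hd (hc.trans (SimpleGraph.Adj.reachable h))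
    have hKe : K.edgeSet = insert s(c, d) (T.edgeSet \ {s(a, b)}) := by
      rw [hK, SimpleGraph.edgeSet_sup, SimpleGraph.edgeSet_fromEdgeSet,
        SimpleGraph.edgeSet_deleteEdges, Set.union_comm]
      ext e
      simp only [Set.mem_union, Set.mem_sdiff, Set.mem_singleton_iff, Set.mem_insert_iff]
      constructor
      · rintro (h | h)
        · exact .inl h.1
        · exact .inr h
      · rintro (rfl | h)
        · exact .inl ⟨rfl, by simpa using hcd.ne⟩
        · exact .inr h
    rw [SimpleGraph.edgeSet_deleteEdges] at hgT
    have hKT : K.IsTree := by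
      rw [SimpleGraph.isTree_iff_connected_and_card]
      refine ⟨connected_exchange hT.connected hc hd' hcd.ne, ?_⟩
      rw [← (SimpleGraph.isTree_iff_connected_and_card.1 hT).2, Nat.card_coe_set_eq,
        Nat.card_coe_set_eq, hKe, Set.ncard_insert_of_notMem hgT (Set.toFinite _),
        Set.ncard_sdiff_singleton_add_one hfT (Set.toFinite _)]
    have hKG : K ≤ G := by
      refine sup_le ((SimpleGraph.deleteEdges_le _).trans hTG) ?_
      rw [SimpleGraph.fromEdgeSet_le]
      rintro e ⟨rfl, -⟩
      exact hHG hcd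
    have hKn : (K.edgeSet \ H.edgeSet).ncard = n := by
      have hdiff : K.edgeSet \ H.edgeSet = (T.edgeSet \ H.edgeSet) \ {s(a, b)} := by
        have hcd' : s(c, d) ∈ H.edgeSet := hcd
        rw [hKe, Set.insert_sdiff_of_mem _ hcd', Set.sdiff_sdiff_comm]
      rw [hdiff]
      have := Set.ncard_sdiff_singleton_add_one
        (show s(a, b) ∈ T.edgeSet \ H.edgeSet from ⟨hfT, hfH⟩) (Set.toFinite _)
      omega
    obtain ⟨T', h1, h2, h3⟩ := ih K hKG hKT hKn
    refine ⟨T', h1, h2, h3.trans ?_⟩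
    rw [weight_eq_sum_filter, weight_eq_sum_filter]
    have hfil : (Finset.univ.filter (· ∈ K.edgeSet)) =
        insert s(c, d) ((Finset.univ.filter (· ∈ T.edgeSet)).erase s(a, b)) := by
      ext e
      simp only [hKe, Finset.mem_filter, Finset.mem_univ, true_and, Finset.mem_insert,
        Finset.mem_erase, Set.mem_insert_iff, Set.mem_sdiff, Set.mem_singleton_iff]
      tauto
    have hmem : s(a, b) ∈ Finset.univ.filter (· ∈ T.edgeSet) := by simpa using hfT
    rw [hfil, Finset.sum_insert (fun h => hgT (by
      rw [Finset.mem_erase, Finset.mem_filter] at h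
      exact ⟨h.2.2, h.1⟩)), ← Finset.add_sum_erase _ _ hmem]
    linarith

/-! ### Euler tours and embedding the tree in an interval -/

/-- A closed walk that misses a vertex is enlarged by an excursion `y, z, y` to an unvisited `z`.
The edge `yz` was unused before, so it is now used exactly twice. -/
theorem exists_closed_walk_count_le_two [Fintype V] [DecidableEq V] {T : SimpleGraph V}
    (hT : T.Connected) (r : V) : ∃ p : T.Walk r r, (∀ e, p.edges.count e ≤ 2) ∧
      ∀ v, v ∈ p.support := by
  have key : ∀ n : ℕ, ∃ p : T.Walk r r, (∀ e, p.edges.count e ≤ 2) ∧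
      ((∀ v, v ∈ p.support) ∨ n ≤ p.support.toFinset.card) := by
    intro n
    induction n with
    | zero => exact ⟨.nil, by simp, by simp⟩
    | succ n ih =>
      obtain ⟨p, hp, hp' | hp'⟩ := ih
      · exact ⟨p, hp, .inl hp'⟩
      by_cases hall : ∀ v, v ∈ p.support
      · exact ⟨p, hp, .inl hall⟩
      push Not at hall
      obtain ⟨v, hv⟩ := hall
      obtain ⟨q⟩ := hT r v
      obtain ⟨⟨⟨y, z⟩, hyz⟩, -, hy, hz⟩ := q.exists_boundary_dart {x | x ∈ p.support}
        p.start_mem_support hv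
      change y ∈ p.support at hy
      change z ∉ p.support at hz
      change T.Adj y z at hyz
      have hspec := p.take_spec hy
      refine ⟨(p.takeUntil y hy).append (.cons hyz (.cons hyz.symm (p.dropUntil y hy))), ?_,
        .inr ?_⟩
      · intro e
        have h1 := hp e
        rw [← hspec, SimpleGraph.Walk.edges_append, List.count_append] at h1
        rw [SimpleGraph.Walk.edges_append, List.count_append, SimpleGraph.Walk.edges_cons,
          SimpleGraph.Walk.edges_cons, List.count_cons, List.count_cons, Sym2.eq_swap (a := z)]
        by_cases he : s(y, z) = e
        · have h0 : p.edges.count e = 0 := List.count_eq_zero.2 fun h =>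
            hz (p.snd_mem_support_of_mem_edges (he ▸ h))
          rw [← hspec, SimpleGraph.Walk.edges_append, List.count_append] at h0
          simp only [he, beq_self_eq_true, if_true]
          omega
        · simp only [beq_iff_eq, he, if_false]
          omega
      · have hsub : insert z p.support.toFinset ⊆ ((p.takeUntil y hy).append
            (.cons hyz (.cons hyz.symm (p.dropUntil y hy)))).support.toFinset := by
          intro x hx
          rw [Finset.mem_insert, List.mem_toFinset, ← hspec,
            SimpleGraph.Walk.mem_support_append_iff] at hx
          rw [List.mem_toFinset, SimpleGraph.Walk.mem_support_append_iff,
            SimpleGraph.Walk.support_cons, SimpleGraph.Walk.support_cons, List.mem_cons,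
            List.mem_cons]
          tauto
        refine le_trans ?_ (Finset.card_le_card hsub)
        rw [Finset.card_insert_of_notMem (by simpa using hz)]
        omega
  obtain ⟨p, hp, hp' | hp'⟩ := key (Fintype.card V + 1)
  · exact ⟨p, hp, hp'⟩
  · have := Finset.card_le_univ p.support.toFinset
    omega

/-- `P x` is the length of the walk up to the first visit to `x`; the portion between two first
visits joins the two vertices. -/
theorem exists_potential_of_walk {T : SimpleGraph V} (hw : ∀ e ∈ T.edgeSet, 0 ≤ w e) {r s : V}
    (p : T.Walk r s) : ∃ P : V → ℝ, ∀ x ∈ p.support, 0 ≤ P x ∧ P x ≤ (p.edges.map w).sum ∧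
      Within w T r x (P x) ∧ ∀ y ∈ p.support, Within w T x y |P x - P y| := by
  classical
  induction p with
  | nil =>
    refine ⟨fun _ => 0, fun x hx => ?_⟩
    obtain rfl : x = _ := by simpa using hx
    refine ⟨le_rfl, by simp, .refl _ _, fun y hy => ?_⟩
    obtain rfl : y = _ := by simpa using hy
    simpa using Within.refl T _
  | @cons r z s h p ih =>
    obtain ⟨P, hP⟩ := ih
    have h0 : 0 ≤ w s(r, z) := hw _ h
    have hs : 0 ≤ (p.edges.map w).sum := Within.nonneg hw ⟨p, le_rfl⟩
    refine ⟨fun x => if x = r then 0 else w s(r, z) + P x, fun x hx => ?_⟩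
    rw [SimpleGraph.Walk.edges_cons, List.map_cons, List.sum_cons]
    have hmem : ∀ x ∈ (SimpleGraph.Walk.cons h p).support, x ≠ r → x ∈ p.support := by
      intro x hx hxr
      rw [SimpleGraph.Walk.support_cons, List.mem_cons] at hx
      exact hx.resolve_left hxr
    have hfrom : ∀ x ∈ p.support, Within w T r x (w s(r, z) + P x) := fun x hx =>
      (Within.of_adj h).trans (hP x hx).2.2.1
    by_cases hxr : x = r
    · subst hxr
      simp only [if_true]
      refine ⟨le_rfl, by linarith, .refl _ _, fun y hy => ?_⟩
      split_ifs with hyr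
      · subst hyr; simpa using Within.refl T _
      · have hy' := hmem y hy hyr
        refine (hfrom y hy').le ?_
        have := (hP y hy').1
        rw [zero_sub, abs_neg]
        exact le_abs_self _
    · have hx' := hmem x hx hxr
      obtain ⟨h1, h2, h3, h4⟩ := hP x hx'
      simp only [if_neg hxr]
      refine ⟨by linarith, by linarith, hfrom x hx', fun y hy => ?_⟩
      split_ifs with hyr
      · subst hyr
        refine (hfrom x hx').symm.le ?_
        rw [sub_zero]
        exact le_abs_self _
      · have := h4 y (hmem y hy hyr)
        rwa [add_sub_add_left_eq_sub]

/-- A connected graph of total weight `L` maps to the interval `[0, 2L]` so that its distances are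
at most the distances of the images. -/
theorem exists_potential [Fintype V] {T : SimpleGraph V} (hT : T.Connected)
    (hw : ∀ e ∈ T.edgeSet, 0 ≤ w e) : ∃ P : V → ℝ, (∀ x, 0 ≤ P x ∧ P x ≤ 2 * weight w T) ∧
      ∀ x y, Within w T x y |P x - P y| := by
  classical
  obtain ⟨r⟩ := hT.nonempty
  obtain ⟨p, hp, hall⟩ := exists_closed_walk_count_le_two hT r
  obtain ⟨P, hP⟩ := exists_potential_of_walk hw p
  have hsum : (p.edges.map w).sum ≤ 2 * weight w T := by
    rw [Finset.sum_list_map_count, weight_eq_sum_filter, Finset.mul_sum]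
    have hsub : p.edges.toFinset ⊆ Finset.univ.filter (· ∈ T.edgeSet) := fun e he => by
      simpa using p.edges_subset_edgeSet (List.mem_toFinset.1 he)
    refine (Finset.sum_le_sum fun e he => ?_).trans
      (Finset.sum_le_sum_of_subset_of_nonneg hsub fun e he _ => ?_)
    · rw [nsmul_eq_mul]
      refine mul_le_mul_of_nonneg_right ?_
        (hw e (p.edges_subset_edgeSet (List.mem_toFinset.1 he)))
      exact_mod_cast hp e
    · exact mul_nonneg zero_le_two (hw e (Finset.mem_filter.1 he).2)
  exact ⟨P, fun x => ⟨(hP x (hall x)).1, (hP x (hall x)).2.1.trans hsum⟩,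
    fun x y => (hP x (hall x)).2.2.2 y (hall y)⟩

/-! ### The blow-up graph and its girth -/

section BlowUp

/-- A traversal of one of the copies of the edge `{fst, snd}` in a blow-up. -/
structure Step (V : Type u) where
  fst : V
  snd : V
  shift : ℕ

namespace Step

/-- The edge a copy of which is traversed. -/
def edge (s : Step V) : Sym2 V := s(s.fst, s.snd)

/-- The cell at which the step begins, where `a` assigns cells to vertices. -/
def source (a : V → ℕ) (s : Step V) : ℕ := a s.fst + s.shift

/-- The cell at which the step ends, where `a` assigns cells to vertices. -/
def target (a : V → ℕ) (s : Step V) : ℕ := a s.snd + s.shift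

/-- The same copy traversed in the opposite direction. -/
def swap (s : Step V) : Step V := ⟨s.snd, s.fst, s.shift⟩

theorem edge_swap (s : Step V) : s.swap.edge = s.edge := Sym2.eq_swap

end Step

/-- The first `j` steps of `s` form a walk in the blow-up that replaces every edge `e` of `B` by
`c e` parallel copies, and they traverse copies of pairwise different edges. -/
structure IsStepChain (a : V → ℕ) (B : Finset (Sym2 V)) (c : Sym2 V → ℕ) (j : ℕ) (s : ℕ → Step V) :
    Prop where
  mem : ∀ r < j, (s r).edge ∈ B
  shift_lt : ∀ r < j, (s r).shift < c (s r).edge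
  injOn : ∀ r < j, ∀ r' < j, (s r).edge = (s r').edge → r = r'
  target_eq : ∀ r, r + 1 < j → (s r).target a = (s (r + 1)).source a

/-- No walk in the blow-up with at most `2k` steps along pairwise different edges closes up, and no
such walk with at most `k` steps returns to within less than `k` cells of its beginning. -/
def NoShortChain (a : V → ℕ) (B : Finset (Sym2 V)) (c : Sym2 V → ℕ) (k : ℕ) : Prop :=
  ∀ (j : ℕ) (s : ℕ → Step V), IsStepChain a B c (j + 1) s →
    ¬ (j + 1 ≤ 2 * k ∧ (s j).target a = (s 0).source a) ∧
    ¬ (j + 1 ≤ k ∧ (s j).target a < (s 0).source a + k ∧ (s 0).source a < (s j).target a + k)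

/-- The blow-up that replaces every edge `{x, y}` of `B` by copies `{a x + i, a y + i}`. -/
def blowUp (a : V → ℕ) (B : Finset (Sym2 V)) (c : Sym2 V → ℕ) (N : ℕ) : SimpleGraph (Fin N) where
  Adj x y := x ≠ y ∧ ∃ s : Step V, s.edge ∈ B ∧ s.shift < c s.edge ∧
    s.source a = x ∧ s.target a = y
  symm := ⟨fun _ _ ⟨hne, s, h1, h2, h3, h4⟩ =>
    ⟨hne.symm, s.swap, by rwa [s.edge_swap], by rwa [s.edge_swap], h4, h3⟩⟩
  loopless := ⟨fun _ h => h.1 rfl⟩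

variable {a : V → ℕ} {B : Finset (Sym2 V)} {c : Sym2 V → ℕ} {k N : ℕ}

/-- In a periodic sequence of steps without backtracking, two steps along the same edge that are
at most `k` apart yield a short chain that nearly closes up. -/
theorem NoShortChain.false_of_near_repetition (h : NoShortChain a B c k) (hc : ∀ e ∈ B, c e ≤ k)
    {s : ℕ → Step V} (hB : ∀ r, (s r).edge ∈ B) (hs : ∀ r, (s r).shift < c (s r).edge)
    (ht : ∀ r, (s r).target a = (s (r + 1)).source a)
    (hback : ∀ r, (s r).source a ≠ (s (r + 1)).target a)
    (hrep : ∃ d, 0 < d ∧ d ≤ k ∧ ∃ p, (s p).edge = (s (p + d)).edge) : False := by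
  classical
  -- With the least gap `d`, any `d` consecutive steps use different edges and hence form a chain.
  obtain ⟨hd0, hdk, p, hp⟩ := Nat.find_spec hrep
  have hmin := fun m hm => Nat.find_min hrep (m := m) hm
  set d := Nat.find hrep
  have hinj : ∀ r r', r < r' → r' < r + d → (s r).edge ≠ (s r').edge := by
    intro r r' h1 h2 he
    refine hmin (r' - r) (by omega) ⟨by omega, by omega, r, ?_⟩
    rw [he]; congr 2; omega
  have hchain : ∀ p' j, j ≤ d → IsStepChain a B c j fun r => s (p' + r) := by
    intro p' j hj
    refine ⟨fun r _ => hB _, fun r _ => hs _, fun r hr r' hr' he => ?_, fun r _ => ht _⟩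
    rcases lt_trichotomy r r' with hlt | heq | hlt
    · exact absurd he (hinj _ _ (by omega) (by omega))
    · exact heq
    · exact absurd he.symm (hinj _ _ (by omega) (by omega))
  have h1 := (hs p).trans_le (hc _ (hB p))
  have h2 := (hs (p + d)).trans_le (hc _ (hB (p + d)))
  rcases Sym2.eq_iff.1 hp with ⟨e1, e2⟩ | ⟨e1, e2⟩
  -- Same direction: the `d` steps from `p` on end at another copy of their starting point. Both
  -- shifts are less than `k`, so the two cells are less than `k` apart.
  · have htar : (s (p + (d - 1))).target a = (s (p + d)).source a := by
      rw [ht]; congr 2; omega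
    refine (h (d - 1) _ (hchain p (d - 1 + 1) (by omega))).2 ⟨by omega, ?_⟩
    simp only [add_zero, htar, Step.source, e1]
    omega
  -- Opposite directions: the two repeated steps are left out and the `d - 1` steps between them
  -- nearly close up. For `d = 1` there are none, but then the shifts agree and the walk backtracks.
  · by_cases hd1 : d = 1
    · have h3 := ht p
      have h4 := hback p
      rw [hd1] at e1 e2
      simp only [Step.source, Step.target, e1, e2] at h3 h4
      omega
    · have htar : (s (p + 1 + (d - 2))).target a = (s (p + d)).source a := by
        rw [ht]; congr 2; omega
      refine (h (d - 2) _ (hchain (p + 1) (d - 2 + 1) (by omega))).2 ⟨by omega, ?_⟩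
      have h3 : (s (p + d)).source a = a (s p).snd + (s (p + d)).shift := by
        rw [Step.source, e2]
      have h4 : (s p).target a = a (s p).snd + (s p).shift := rfl
      have h5 := ht p
      simp only [add_zero]
      omega

/-- A cycle of length at most `2k` along different edges is a chain that closes up. A cycle using
two copies of one edge is handled by near repetition, which is why chains that only nearly close up
are excluded as well. -/
theorem NoShortChain.girth_blowUp (h : NoShortChain a B c k) (hc : ∀ e ∈ B, c e ≤ k) (v : Fin N)
    (p : (blowUp a B c N).Walk v v) (hp : p.IsCycle) : 2 * k < p.length := by
  by_contra! hlen
  have h3 := hp.three_le_length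
  set l := p.length with hl
  have hadj : ∀ i : ℕ, ∃ s : Step V, s.edge ∈ B ∧ s.shift < c s.edge ∧
      s.source a = p.getVert (i % l) ∧ s.target a = p.getVert (i % l + 1) := fun i =>
    (p.adj_getVert_succ (Nat.mod_lt i (by omega))).2
  choose f hf1 hf2 hf3 hf4 using hadj
  let s : ℕ → Step V := fun r => f (r % l)
  have hs3 : ∀ r, (s r).source a = p.getVert (r % l) := fun r => by
    simp only [s, hf3, Nat.mod_mod]
  have hs4 : ∀ r, (s r).target a = p.getVert ((r + 1) % l) := fun r => by
    simp only [s, hf4, Nat.mod_mod]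
    rw [Nat.add_mod, Nat.mod_eq_of_lt (by omega : 1 < l)]
    have hlt : r % l < l := Nat.mod_lt r (by omega)
    rcases Nat.lt_or_ge (r % l + 1) l with h1 | h1
    · rw [Nat.mod_eq_of_lt h1]
    · have h2 : r % l + 1 = l := by omega
      rw [h2, Nat.mod_self, hl, p.getVert_length, p.getVert_zero]
  have ht : ∀ r, (s r).target a = (s (r + 1)).source a := fun r => by rw [hs3, hs4]
  have hback : ∀ r, (s r).source a ≠ (s (r + 1)).target a := by
    intro r he
    rw [hs3, hs4, Fin.val_inj] at he
    have hlt : ∀ r, r % l ≤ l - 1 := fun r => by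
      have := Nat.mod_lt r (by omega : l > 0)
      omega
    have h1 : r ≡ r + 2 [MOD l] := hp.getVert_injOn' (hlt r) (hlt _) he
    have h2 := Nat.le_of_dvd (by omega) ((Nat.modEq_iff_dvd' (by omega)).1 h1)
    omega
  by_cases hinj : ∀ r < l, ∀ r' < l, (s r).edge = (s r').edge → r = r'
  · refine (h (l - 1) s ?_).1 ⟨by omega, ?_⟩
    · rw [Nat.sub_add_cancel (by omega)]
      exact ⟨fun r _ => hf1 _, fun r _ => hf2 _, hinj, fun r _ => ht r⟩
    · rw [hs4, hs3, Nat.sub_add_cancel (by omega), Nat.mod_self, Nat.zero_mod]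
  -- The two gaps between the repeated steps, measured around the cycle, add up to `l ≤ 2k`, so one
  -- of them is at most `k`.
  · refine h.false_of_near_repetition hc (fun r => hf1 _) (fun r => hf2 _) ht hback ?_
    obtain ⟨r, r', hrr, hr', he⟩ : ∃ r r', r < r' ∧ r' < l ∧ (s r).edge = (s r').edge := by
      push Not at hinj
      obtain ⟨r, hr, r', hr', he, hne⟩ := hinj
      rcases Nat.lt_or_gt_of_ne hne with h1 | h1
      · exact ⟨r, r', h1, hr', he⟩
      · exact ⟨r', r, h1, hr, he.symm⟩
    rcases Nat.lt_or_ge k (r' - r) with h1 | h1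
    · refine ⟨r + l - r', by omega, by omega, r', ?_⟩
      rw [← he]
      have : r' + (r + l - r') = r + l := by omega
      simp only [this, s, Nat.add_mod_right]
    · exact ⟨r' - r, by omega, h1, r, by rw [he]; congr 2; omega⟩

theorem NoShortChain.ne_of_mem (h : NoShortChain a B c k) (hk : k ≠ 0) {x y : V}
    (hB : s(x, y) ∈ B) (hc : 0 < c s(x, y)) : a x ≠ a y := by
  intro hxy
  refine (h 0 (fun _ => ⟨x, y, 0⟩) ⟨fun _ _ => hB, fun _ _ => hc, fun r hr r' hr' _ => by omega,
    fun r hr => by omega⟩).1 ⟨by omega, ?_⟩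
  simp [Step.source, Step.target, hxy]

/-- Traversing one copy forward and the other backward is a closed chain of two steps unless the
underlying edges agree. -/
theorem NoShortChain.copy_injective (h : NoShortChain a B c k) (hk : k ≠ 0) {e f : Sym2 V}
    {i j : ℕ} (he : e ∈ B) (hf : f ∈ B) (hi : i < c e) (hj : j < c f)
    (heq : e.map (fun x => a x + i) = f.map (fun x => a x + j)) : e = f ∧ i = j := by
  induction e using Sym2.ind with | _ x y
  induction f using Sym2.ind with | _ x' y'
  rw [Sym2.map_mk, Sym2.map_mk] at heq
  have hne := h.ne_of_mem hk he (by omega)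
  have key : ∀ x' y', s(x', y') ∈ B → j < c s(x', y') → a x + i = a x' + j → a y + i = a y' + j →
      s(x, y) = s(x', y') := by
    intro x' y' hB hj hx hy
    by_contra hne'
    let s : ℕ → Step V := fun r => if r = 0 then ⟨x, y, i⟩ else ⟨y', x', j⟩
    have hs0 : s 0 = ⟨x, y, i⟩ := rfl
    have hs1 : s 1 = ⟨y', x', j⟩ := rfl
    have hB' : s(y', x') ∈ B := by rwa [Sym2.eq_swap]
    have hj' : j < c s(y', x') := by rwa [Sym2.eq_swap]
    have hne1 : s(x, y) ≠ s(y', x') := by rwa [Sym2.eq_swap (a := y')]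
    refine (h 1 s ⟨?_, ?_, ?_, ?_⟩).1 ⟨by omega, ?_⟩
    · intro r hr; interval_cases r
      exacts [he, hB']
    · intro r hr; interval_cases r
      exacts [hi, hj']
    · intro r hr r' hr' h1
      interval_cases r <;> interval_cases r'
      exacts [rfl, absurd h1 hne1, absurd h1.symm hne1, rfl]
    · intro r hr
      obtain rfl : r = 0 := by omega
      simp [hs0, hs1, Step.source, Step.target, hy]
    · simp [hs0, hs1, Step.source, Step.target, hx]
  rcases Sym2.eq_iff.1 heq with ⟨h1, h2⟩ | ⟨h1, h2⟩
  · have h3 := key x' y' hf hj h1 h2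
    refine ⟨h3, ?_⟩
    rcases Sym2.eq_iff.1 h3 with ⟨rfl, rfl⟩ | ⟨rfl, rfl⟩ <;> omega
  · have h3 := key y' x' (by rwa [Sym2.eq_swap]) (by rwa [Sym2.eq_swap]) h1 h2
    rw [Sym2.eq_swap (a := y')] at h3
    refine ⟨h3, ?_⟩
    rcases Sym2.eq_iff.1 h3 with ⟨rfl, rfl⟩ | ⟨rfl, rfl⟩ <;> omega

theorem NoShortChain.sum_le (h : NoShortChain a B c k) (hk : k ≠ 0) (hc : ∀ e ∈ B, c e ≤ k)
    (hN : ∀ x, a x + k ≤ N) : (∑ e ∈ B, c e : ℝ) ≤ 2 * (N : ℝ) ^ (1 + 1 / (k : ℝ)) := by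
  classical
  have hMoore := card_edgeFinset_le_of_girth hk fun v p hp => h.girth_blowUp (N := N) hc v p hp
  rw [Fintype.card_fin] at hMoore
  refine le_trans ?_ hMoore
  have hcard : (B.sigma fun e => Finset.range (c e)).card ≤ (blowUp a B c N).edgeFinset.card := by
    rw [← Finset.card_image_of_injOn (s := (blowUp a B c N).edgeFinset)
      (f := Sym2.map (Fin.val : Fin N → ℕ)) (Sym2.map.injective Fin.val_injective).injOn]
    refine Finset.card_le_card_of_injOn (fun z => z.1.map fun x => a x + z.2) ?_ ?_
    · rintro ⟨e, i⟩ hz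
      obtain ⟨he, hi⟩ : e ∈ B ∧ i < c e := by simpa using hz
      have hik := hi.trans_le (hc e he)
      induction e using Sym2.ind with | _ x y
      have hx := hN x
      have hy := hN y
      refine Finset.mem_coe.2 (Finset.mem_image.2
        ⟨s(⟨a x + i, by omega⟩, ⟨a y + i, by omega⟩), ?_, by simp⟩)
      rw [SimpleGraph.mem_edgeFinset, SimpleGraph.mem_edgeSet]
      refine ⟨?_, ⟨x, y, i⟩, he, hi, rfl, rfl⟩
      have := h.ne_of_mem hk he (by omega)
      simpa using this
    · rintro ⟨e, i⟩ hz ⟨f, j⟩ hz' heq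
      obtain ⟨he, hi⟩ : e ∈ B ∧ i < c e := by simpa using hz
      obtain ⟨hf, hj⟩ : f ∈ B ∧ j < c f := by simpa using hz'
      obtain ⟨rfl, rfl⟩ := h.copy_injective hk he hf hi hj heq
      rfl
  rw [Finset.card_sigma] at hcard
  simp only [Finset.card_range] at hcard
  exact_mod_cast hcard

end BlowUp

/-! ### The weight of one class of edges -/

theorem abs_sub_le_of_floor {P : V → ℝ} {δ : ℝ} (hδ : 0 < δ) (hP : ∀ x, 0 ≤ P x) {x y : V} {M : ℝ}
    (h1 : (⌊P x / δ⌋₊ : ℝ) - ⌊P y / δ⌋₊ + 1 ≤ M) (h2 : (⌊P y / δ⌋₊ : ℝ) - ⌊P x / δ⌋₊ + 1 ≤ M) :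
    |P x - P y| ≤ M * δ := by
  have hlo : ∀ x, (⌊P x / δ⌋₊ : ℝ) * δ ≤ P x := fun x =>
    (le_div_iff₀ hδ).1 (Nat.floor_le (div_nonneg (hP x) hδ.le))
  have hhi : ∀ x, P x < ((⌊P x / δ⌋₊ : ℝ) + 1) * δ := fun x =>
    (div_lt_iff₀ hδ).1 (Nat.lt_floor_add_one _)
  have := hlo x
  have := hlo y
  have := hhi x
  have := hhi y
  have := mul_le_mul_of_nonneg_right h1 hδ.le
  have := mul_le_mul_of_nonneg_right h2 hδ.le
  rw [abs_le]
  constructor <;> linarith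

/-- If no edge of `H` can be replaced by a detour of stretch `(2k-1)(1+ε)`, then the cells of length
`ε w₀ / 2` of a potential of the spanning tree `T` admit no short chains along edges outside `T`. -/
theorem noShortChain_of_not_within {H T : SimpleGraph V} {P : V → ℝ} {k : ℕ} {ε w₀ : ℝ}
    (hk : 1 ≤ k) (hε : 0 < ε) (hw₀ : 0 < w₀) (hTH : T ≤ H) (hP0 : ∀ x, 0 ≤ P x)
    (hP : ∀ x y, Within w T x y |P x - P y|)
    (hH : ∀ x y, H.Adj x y →
      ¬ Within w (H.deleteEdges {s(x, y)}) x y ((2 * k - 1) * (1 + ε) * w s(x, y)))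
    {B : Finset (Sym2 V)} (hBH : ∀ e ∈ B, e ∈ H.edgeSet) (hBT : ∀ e ∈ B, e ∉ T.edgeSet)
    (hBw : ∀ e ∈ B, w₀ ≤ w e) :
    NoShortChain (fun x => ⌊P x / (ε * w₀ / 2)⌋₊) B (fun e => ⌊w e / w₀⌋₊) k := by
  intro j s hs
  set δ := ε * w₀ / 2 with hδdef
  have hδ : 0 < δ := by positivity
  obtain ⟨r₀, hr₀, hmax⟩ := Finset.exists_max_image (Finset.range (j + 1)) (fun r => w (s r).edge)
    ⟨0, by simp⟩
  rw [Finset.mem_range] at hr₀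
  set X := w (s r₀).edge with hX
  have hmax' : ∀ r ≤ j, w (s r).edge ≤ X := fun r hr => hmax r (Finset.mem_range.2 (by omega))
  have hXw : w₀ ≤ X := hBw _ (hs.mem r₀ hr₀)
  have hX0 : 0 < X := hw₀.trans_le hXw
  have hδX : X / w₀ * δ = ε * X / 2 := by rw [hδdef]; field_simp
  have hδX' : δ ≤ ε * X / 2 := by rw [hδdef]; nlinarith
  set K := H.deleteEdges {(s r₀).edge} with hK
  have hTK : T ≤ K := by
    intro x y hxy
    rw [hK, SimpleGraph.deleteEdges_adj]
    refine ⟨hTH hxy, fun h => hBT _ (hs.mem r₀ hr₀) ?_⟩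
    rw [← Set.mem_singleton_iff.1 h]
    exact hxy
  have hshift : ∀ r ≤ j, ((s r).shift : ℝ) + 1 ≤ X / w₀ := by
    intro r hr
    have h1 : (s r).shift + 1 ≤ ⌊w (s r).edge / w₀⌋₊ := hs.shift_lt r (by omega)
    have h2 : (((s r).shift + 1 : ℕ) : ℝ) ≤ w (s r).edge / w₀ := by
      refine (Nat.le_floor_iff (div_nonneg ?_ hw₀.le)).1 h1
      exact hw₀.le.trans (hBw _ (hs.mem r (by omega)))
    push_cast at h2
    exact h2.trans (div_le_div_of_nonneg_right (hmax' r hr) hw₀.le)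
  have hstep : ∀ r ≤ j, r ≠ r₀ → Within w K (s r).fst (s r).snd X := by
    intro r hr hne
    have hadj : K.Adj (s r).fst (s r).snd := by
      rw [hK, SimpleGraph.deleteEdges_adj]
      exact ⟨hBH _ (hs.mem r (by omega)), fun h => hne (hs.injOn r (by omega) r₀ hr₀ h)⟩
    exact (Within.of_adj hadj).le (hmax' r hr)
  -- Two vertices whose shifted cells coincide lie in cells differing by a difference of shifts, at
  -- most `X / w₀ - 1`. They are thus within `(X / w₀) * δ = ε X / 2` in `T`.
  have hjump : ∀ r ≤ j, ∀ r' ≤ j, (s r).target (fun x => ⌊P x / δ⌋₊) =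
      (s r').source (fun x => ⌊P x / δ⌋₊) → Within w K (s r).snd (s r').fst (ε * X / 2) := by
    intro r hr r' hr' heq
    have heq' : (⌊P (s r).snd / δ⌋₊ : ℝ) + (s r).shift = ⌊P (s r').fst / δ⌋₊ + (s r').shift := by
      exact_mod_cast heq
    have h1 := hshift r hr
    have h2 := hshift r' hr'
    have h3 : (0 : ℝ) ≤ (s r).shift := Nat.cast_nonneg _
    have h4 : (0 : ℝ) ≤ (s r').shift := Nat.cast_nonneg _
    rw [← hδX]
    exact ((hP _ _).mono hTK).le (abs_sub_le_of_floor hδ hP0 (by linarith) (by linarith))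
  have hfwd : ∀ r, r₀ + r ≤ j →
      Within w K (s r₀).snd (s (r₀ + r)).snd (r * ((1 + ε / 2) * X)) := by
    intro r
    induction r with
    | zero => intro _; simpa using Within.refl K _
    | succ r ih =>
      intro hr
      have h1 := hjump (r₀ + r) (by omega) (r₀ + r + 1) hr (hs.target_eq _ (by omega))
      have h2 := hstep (r₀ + r + 1) hr (by omega)
      refine (((ih (by omega)).trans h1).trans h2).le ?_
      push_cast
      linarith
  have hbwd : ∀ r ≤ r₀, Within w K (s 0).fst (s r).fst (r * ((1 + ε / 2) * X)) := by
    intro r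
    induction r with
    | zero => intro _; simpa using Within.refl K _
    | succ r ih =>
      intro hr
      have h1 := hjump r (by omega) (r + 1) (by omega) (hs.target_eq _ (by omega))
      have h2 := hstep r (by omega) (by omega)
      refine (((ih (by omega)).trans h2).trans h1).le ?_
      push_cast
      linarith
  -- From the end of the heaviest step, go forward to the end of the chain, close the gap at cost
  -- `g`, and continue to the start of the heaviest step. This uses the `j` other edges and `j`
  -- jumps.
  have hclose : ∀ g, Within w K (s j).snd (s 0).fst g →
      (2 * k - 1) * (1 + ε) * X < j * ((1 + ε / 2) * X) + g := by
    intro g hg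
    by_contra! hle
    have h1 := hfwd (j - r₀) (by omega)
    rw [show r₀ + (j - r₀) = j by omega] at h1
    have h2 := ((h1.trans hg).trans (hbwd r₀ le_rfl)).symm
    refine hH (s r₀).fst (s r₀).snd (hBH _ (hs.mem r₀ hr₀)) (h2.le (le_trans ?_ hle))
    rw [Nat.cast_sub (by omega)]
    linarith
  have hk' : (1 : ℝ) ≤ k := by exact_mod_cast hk
  have hεX : 0 < ε * X := by positivity
  constructor
  -- The detour weighs at most `j X + (j + 1) ε X / 2 ≤ (2k - 1) X + k ε X`, and `k ≤ 2k - 1`.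
  · rintro ⟨hj, heq⟩
    have h1 := hclose _ (hjump j le_rfl 0 (by omega) heq)
    have h2 : (j : ℝ) + 1 ≤ 2 * k := by exact_mod_cast hj
    nlinarith
  · rintro ⟨hj, hlt, hlt'⟩
    have h2 : (j : ℝ) + 1 ≤ k := by exact_mod_cast hj
    have hlt1 : (⌊P (s j).snd / δ⌋₊ : ℝ) + (s j).shift + 1 ≤
        ⌊P (s 0).fst / δ⌋₊ + (s 0).shift + k := by exact_mod_cast hlt
    have hlt2 : (⌊P (s 0).fst / δ⌋₊ : ℝ) + (s 0).shift + 1 ≤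
        ⌊P (s j).snd / δ⌋₊ + (s j).shift + k := by exact_mod_cast hlt'
    have h3 := hshift j le_rfl
    have h4 := hshift 0 (by omega)
    have h5 : (0 : ℝ) ≤ (s j).shift := Nat.cast_nonneg _
    have h6 : (0 : ℝ) ≤ (s 0).shift := Nat.cast_nonneg _
    have h7 := hclose _ (((hP (s j).snd (s 0).fst).mono hTK).le
      (abs_sub_le_of_floor (M := X / w₀ + (k - 1)) hδ hP0 (by linarith) (by linarith)))
    rw [add_mul (X / w₀), hδX] at h7
    have h8 : ((k : ℝ) - 1) * δ ≤ (k - 1) * (ε * X / 2) :=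
      mul_le_mul_of_nonneg_left hδX' (by linarith)
    nlinarith

/-- A bound on the total weight of edges of `H` outside the spanning tree `T` that have weights in
`[w₀, k w₀]`. -/
theorem sum_weight_le_of_not_within [Fintype V] {H T : SimpleGraph V} {k : ℕ} {ε w₀ : ℝ}
    (hk : 2 ≤ k) (hε : 0 < ε) (hw₀ : 0 < w₀) (hTH : T ≤ H) (hT : T.Connected)
    (hw : ∀ e ∈ T.edgeSet, 0 ≤ w e)
    (hH : ∀ x y, H.Adj x y →
      ¬ Within w (H.deleteEdges {s(x, y)}) x y ((2 * k - 1) * (1 + ε) * w s(x, y)))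
    {B : Finset (Sym2 V)} (hBH : ∀ e ∈ B, e ∈ H.edgeSet) (hBT : ∀ e ∈ B, e ∉ T.edgeSet)
    (hBw : ∀ e ∈ B, w₀ ≤ w e) (hBw' : ∀ e ∈ B, w e ≤ k * w₀) :
    ∑ e ∈ B, w e ≤ 4 * w₀ * (6 * weight w T / (ε * w₀)) ^ (1 + 1 / (k : ℝ)) := by
  set L := weight w T with hL
  have hL0 : 0 ≤ L := weight_nonneg hw
  rcases B.eq_empty_or_nonempty with rfl | ⟨e₀, he₀⟩
  · rw [Finset.sum_empty]; positivity
  obtain ⟨P, hP0, hP⟩ := exists_potential hT hw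
  have hchain := noShortChain_of_not_within (by omega) hε hw₀ hTH (fun x => (hP0 x).1) hP hH
    hBH hBT hBw
  have hk' : (2 : ℝ) ≤ k := by exact_mod_cast hk
  -- Otherwise `T` itself, with distances at most `2L`, gives a forbidden detour of `e₀`. This
  -- absorbs the `k` extra cells needed for shifts into the number of cells.
  have hkL : k * (ε * w₀) ≤ 2 * L := by
    have he := hBH _ he₀
    have he' := hBT _ he₀
    have hwe := hBw _ he₀
    induction e₀ using Sym2.ind with | _ x y
    by_contra! hlt
    refine hH x y he (((hP x y).mono ?_).le ?_)
    · intro c d hcd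
      rw [SimpleGraph.deleteEdges_adj]
      refine ⟨hTH hcd, fun h => he' ?_⟩
      rw [← Set.mem_singleton_iff.1 h]
      exact hcd
    · have h1 : |P x - P y| ≤ 2 * L := by
        rw [abs_le]
        constructor <;> linarith [hP0 x, hP0 y]
      have h2 : (0 : ℝ) ≤ 2 * k - 1 := by linarith
      have h3 : (2 * k - 1) * (1 + ε) * w₀ ≤ (2 * k - 1) * (1 + ε) * w s(x, y) :=
        mul_le_mul_of_nonneg_left hwe (by positivity)
      have h4 : k * (ε * w₀) ≤ (2 * k - 1) * (ε * w₀) :=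
        mul_le_mul_of_nonneg_right (by linarith) (by positivity)
      have h5 : 0 ≤ (2 * k - 1) * w₀ := by positivity
      linarith
  have hεw : 0 < ε * w₀ := by positivity
  set N := ⌊4 * L / (ε * w₀)⌋₊ + k with hN
  have hNle : (N : ℝ) ≤ 6 * L / (ε * w₀) := by
    have h1 : (⌊4 * L / (ε * w₀)⌋₊ : ℝ) ≤ 4 * L / (ε * w₀) := Nat.floor_le (by positivity)
    have h2 : (k : ℝ) ≤ 2 * L / (ε * w₀) := by rwa [le_div_iff₀ hεw]
    have h3 : 6 * L / (ε * w₀) = 4 * L / (ε * w₀) + 2 * L / (ε * w₀) := by ring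
    rw [hN]; push_cast; linarith
  have hsum := hchain.sum_le (N := N) (by omega)
    (fun e he => by
      have h1 : w e / w₀ ≤ (k : ℝ) := by
        rw [div_le_iff₀ hw₀]; exact hBw' e he
      exact_mod_cast (Nat.floor_le_floor h1).trans_eq (Nat.floor_natCast k))
    (fun x => by
      have h1 : P x / (ε * w₀ / 2) ≤ 4 * L / (ε * w₀) := by
        rw [div_le_div_iff₀ (by positivity) hεw]
        nlinarith [(hP0 x).2]
      have := Nat.floor_le_floor h1
      omega)
  have hsum' : ∑ e ∈ B, w e ≤ 2 * w₀ * ∑ e ∈ B, ((⌊w e / w₀⌋₊ : ℕ) : ℝ) := by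
    rw [Finset.mul_sum]
    refine Finset.sum_le_sum fun e he => ?_
    have h1 : (1 : ℝ) ≤ w e / w₀ := by rw [le_div_iff₀ hw₀]; linarith [hBw e he]
    have h2 : (1 : ℝ) ≤ (⌊w e / w₀⌋₊ : ℕ) := by
      exact_mod_cast (Nat.le_floor (by exact_mod_cast h1))
    have h3 : w e / w₀ < (⌊w e / w₀⌋₊ : ℕ) + 1 := Nat.lt_floor_add_one _
    rw [div_lt_iff₀ hw₀] at h3
    nlinarith
  calc ∑ e ∈ B, w e ≤ 2 * w₀ * ∑ e ∈ B, ((⌊w e / w₀⌋₊ : ℕ) : ℝ) := hsum'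
    _ ≤ 2 * w₀ * (2 * (N : ℝ) ^ (1 + 1 / (k : ℝ))) :=
        mul_le_mul_of_nonneg_left hsum (by positivity)
    _ ≤ 2 * w₀ * (2 * (6 * L / (ε * w₀)) ^ (1 + 1 / (k : ℝ))) := by
        gcongr
    _ = _ := by ring

/-! ### Cycles and the number of edges -/

theorem within_deleteEdges_of_mem_edges {H : SimpleGraph V} {X : ℝ} {e : Sym2 V} {x y : V}
    (p : H.Walk x y) (hnd : p.edges.Nodup) (he : e ∈ p.edges) (hX : ∀ f ∈ p.edges, w f ≤ X) :
    ∃ a b r₁ r₂, e = s(a, b) ∧ Within w (H.deleteEdges {e}) x a r₁ ∧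
      Within w (H.deleteEdges {e}) b y r₂ ∧ r₁ + r₂ ≤ (p.length - 1) * X := by
  induction p with
  | nil => simp at he
  | @cons x z y h p ih =>
    rw [SimpleGraph.Walk.edges_cons, List.nodup_cons] at hnd
    rw [SimpleGraph.Walk.edges_cons, List.mem_cons] at he
    simp only [SimpleGraph.Walk.edges_cons, List.mem_cons, forall_eq_or_imp] at hX
    rw [SimpleGraph.Walk.length_cons]
    push_cast
    by_cases hxz : e = s(x, z)
    · have hep : e ∉ p.edges := hxz ▸ hnd.1
      refine ⟨x, z, 0, p.length * X, hxz, .refl _ _,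
        ⟨p.toDeleteEdges {e} fun f hf h => hep (Set.mem_singleton_iff.1 h ▸ hf), ?_⟩, by linarith⟩
      rw [SimpleGraph.Walk.toDeleteEdges, SimpleGraph.Walk.edges_transfer]
      have := List.sum_le_card_nsmul (p.edges.map w) X (by simpa using hX.2)
      simpa using this
    · obtain ⟨a, b, r₁, r₂, h1, h2, h3, h4⟩ := ih hnd.2 (he.resolve_left hxz) hX.2
      have hadj : (H.deleteEdges {e}).Adj x z :=
        (SimpleGraph.deleteEdges_adj).2 ⟨h, fun h' => hxz (Set.mem_singleton_iff.1 h').symm⟩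
      refine ⟨a, b, w s(x, z) + r₁, r₂, h1, (Within.of_adj hadj).trans h2, h3, ?_⟩
      linarith [hX.1]

/-- If no edge of `H` can be replaced by a detour of stretch `t`, then the cycles of `H` have more
than `t + 1` edges. -/
theorem lt_length_of_isCycle {H : SimpleGraph V} {t : ℝ} (hw : ∀ e ∈ H.edgeSet, 0 < w e)
    (hH : ∀ x y, H.Adj x y → ¬ Within w (H.deleteEdges {s(x, y)}) x y (t * w s(x, y)))
    {v : V} (c : H.Walk v v) (hc : c.IsCycle) : t + 1 < c.length := by
  classical
  have hne : c.edges.toFinset.Nonempty := by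
    rw [List.toFinset_nonempty_iff, ← List.length_pos_iff, SimpleGraph.Walk.length_edges]
    have := hc.three_le_length
    omega
  obtain ⟨e, he, hmax⟩ := Finset.exists_max_image _ w hne
  simp only [List.mem_toFinset] at he hmax
  obtain ⟨a, b, r₁, r₂, h1, h2, h3, h4⟩ :=
    within_deleteEdges_of_mem_edges c hc.edges_nodup he hmax
  have heH := c.edges_subset_edgeSet he
  have hwe := hw e heH
  subst h1
  have h5 : ¬ (c.length - 1) * w s(a, b) ≤ t * w s(a, b) := fun h =>
    hH a b heH ((h3.trans h2).symm.le (by linarith))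
  have h6 := lt_of_mul_lt_mul_right (not_le.1 h5) hwe.le
  linarith

theorem ncard_edgeSet_le_of_not_within [Fintype V] {H : SimpleGraph V} {t : ℝ}
    (hw : ∀ e ∈ H.edgeSet, 0 < w e)
    (hH : ∀ x y, H.Adj x y → ¬ Within w (H.deleteEdges {s(x, y)}) x y (t * w s(x, y)))
    {m : ℕ} (hm : m ≠ 0) (hmt : 2 * (m : ℝ) ≤ t + 1) :
    (H.edgeSet.ncard : ℝ) ≤ 2 * (Fintype.card V : ℝ) ^ (1 + 1 / (m : ℝ)) := by
  classical
  have := card_edgeFinset_le_of_girth hm fun v c hc => by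
    have h1 := hmt.trans_lt (lt_length_of_isCycle hw hH c hc)
    exact_mod_cast h1
  rwa [← SimpleGraph.coe_edgeFinset, Set.ncard_coe_finset]

/-! ### Summation over all classes and the lightness bound -/

/-- The ratio is `exp (-y)` with `y = log k / k ≤ 1`, hence at most `1 / (1 + y)`, so its distance
from 1 is at least `y / 2`. -/
theorem geom_sum_rpow_le {k : ℕ} (hk : 2 ≤ k) (J : ℕ) :
    ∑ j ∈ Finset.range J, ((k : ℝ) ^ (-(1 / (k : ℝ)))) ^ j ≤ 2 * k / Real.log k := by
  have hk1 : (1 : ℝ) < k := by exact_mod_cast (by omega : 1 < k)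
  have hk0 : (0 : ℝ) < k := by linarith
  have hlog : 0 < Real.log k := Real.log_pos hk1
  set y := Real.log k / k with hy
  have hy0 : 0 < y := by positivity
  have hy1 : y ≤ 1 := by
    rw [hy, div_le_one hk0]
    linarith [Real.log_le_sub_one_of_pos hk0]
  set q := (k : ℝ) ^ (-(1 / (k : ℝ))) with hq
  have hqe : q = (Real.exp y)⁻¹ := by
    rw [hq, Real.rpow_def_of_pos hk0, ← Real.exp_neg, hy]
    congr 1; ring
  have hexp : 1 + y ≤ Real.exp y := by linarith [Real.add_one_le_exp y]
  have hq0 : 0 ≤ q := by positivity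
  have hq1 : q * (1 + y) ≤ 1 := by
    rw [hqe, inv_mul_le_iff₀ (Real.exp_pos y)]; linarith
  have hgap : y / 2 ≤ 1 - q := by nlinarith
  have hgeom : (∑ j ∈ Finset.range J, q ^ j) * (1 - q) ≤ 1 := by
    have := geom_sum_mul_neg q J
    rw [this]
    linarith [pow_nonneg hq0 J]
  have hsum0 : 0 ≤ ∑ j ∈ Finset.range J, q ^ j := Finset.sum_nonneg fun j _ => pow_nonneg hq0 j
  have h1 : (∑ j ∈ Finset.range J, q ^ j) * (y / 2) ≤ 1 :=
    (mul_le_mul_of_nonneg_left hgap hsum0).trans hgeom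
  rw [le_div_iff₀ hlog]
  have h2 : Real.log k = y * k := by rw [hy]; field_simp
  rw [h2]
  nlinarith

/-- The class bound at the scale `w₀ = (M / n) k^j`; the constant is `4 * 6 * 6`, from `6 ^ (1 / k)
≤ 6`. -/
theorem bucket_bound_le {k n j : ℕ} {ε M : ℝ} (hk : 2 ≤ k) (hn : 0 < n) (hε : 0 < ε) (hM : 0 < M) :
    4 * (M / n * k ^ j) * (6 * M / (ε * (M / n * k ^ j))) ^ (1 + 1 / (k : ℝ)) ≤
      144 * M * (n : ℝ) ^ (1 / (k : ℝ)) / ε ^ (1 + 1 / (k : ℝ)) *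
        ((k : ℝ) ^ (-(1 / (k : ℝ)))) ^ j := by
  have hk0 : (0 : ℝ) < k := by exact_mod_cast (by omega : 0 < k)
  have hn0 : (0 : ℝ) < n := by exact_mod_cast hn
  set a := 1 / (k : ℝ) with ha
  have ha0 : 0 ≤ a := by positivity
  have ha1 : a ≤ 1 := by
    rw [ha, div_le_one hk0]; exact_mod_cast (by omega : 1 ≤ k)
  have h1 : 6 * M / (ε * (M / n * k ^ j)) = 6 * n / (ε * k ^ j) := by field_simp
  have h6 : (6 : ℝ) ^ a ≤ 6 := by
    simpa using Real.rpow_le_rpow_of_exponent_le (by norm_num : (1 : ℝ) ≤ 6) ha1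
  have hkj : ((k : ℝ) ^ (-a)) ^ j = ((k : ℝ) ^ j) ^ (-a) := by
    rw [← Real.rpow_natCast, ← Real.rpow_natCast, ← Real.rpow_mul hk0.le, ← Real.rpow_mul hk0.le,
      mul_comm]
  have hpos : (0 : ℝ) < k ^ j := by positivity
  have hεa : 0 < ε ^ a := by positivity
  rw [h1, hkj, Real.rpow_add (by positivity), Real.rpow_add hε, Real.rpow_one, Real.rpow_one,
    Real.div_rpow (by positivity) (by positivity), Real.mul_rpow (by positivity) (by positivity),
    Real.mul_rpow (by positivity) (by positivity), Real.rpow_neg hpos.le]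
  have hka : 0 < ((k : ℝ) ^ j) ^ a := by positivity
  have hna : 0 < (n : ℝ) ^ a := by positivity
  have heq : 4 * (M / n * k ^ j) * (6 * n / (ε * k ^ j) *
      ((6 : ℝ) ^ a * (n : ℝ) ^ a / (ε ^ a * ((k : ℝ) ^ j) ^ a))) =
      24 * M * (n : ℝ) ^ a / (ε * ε ^ a) * (((k : ℝ) ^ j) ^ a)⁻¹ * (6 : ℝ) ^ a := by
    field_simp
    ring
  rw [heq]
  have h0 : 0 ≤ 24 * M * (n : ℝ) ^ a / (ε * ε ^ a) * (((k : ℝ) ^ j) ^ a)⁻¹ := by positivity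
  refine (mul_le_mul_of_nonneg_left h6 h0).trans_eq ?_
  ring

/-- The lightness bound for a graph none of whose edges can be replaced by a detour of stretch
`(2k-1)(1+ε)`. -/
theorem weight_le_of_not_within [Fintype V] {H T : SimpleGraph V} {k : ℕ} {ε M : ℝ}
    (hk : 2 ≤ k) (hε : 0 < ε) (hTH : T ≤ H) (hT : T.Connected) (hw : ∀ e ∈ H.edgeSet, 0 < w e)
    (hH : ∀ x y, H.Adj x y →
      ¬ Within w (H.deleteEdges {s(x, y)}) x y ((2 * k - 1) * (1 + ε) * w s(x, y)))
    (hM : 0 < M) (hTM : weight w T ≤ M) :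
    weight w H ≤ 288 * ((Fintype.card V : ℝ) ^ (1 / (k : ℝ)) *
      (1 + k / (ε ^ (1 + 1 / (k : ℝ)) * Real.log k))) * M := by
  classical
  set n := Fintype.card V with hn
  have hn0 : 0 < n := Fintype.card_pos_iff.2 hT.nonempty
  have hn0' : (0 : ℝ) < n := by exact_mod_cast hn0
  have hn1 : (1 : ℝ) ≤ n := by exact_mod_cast hn0
  have hk1 : (1 : ℝ) < k := by exact_mod_cast (by omega : 1 < k)
  have hlog : 0 < Real.log k := Real.log_pos hk1
  have hroot : (1 : ℝ) ≤ (n : ℝ) ^ (1 / (k : ℝ)) := Real.one_le_rpow hn1 (by positivity)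
  have hTw : ∀ e ∈ T.edgeSet, 0 ≤ w e := fun e he => (hw e (SimpleGraph.edgeSet_mono hTH he)).le
  let E : Finset (Sym2 V) := {e | e ∈ H.edgeSet}
  have hE : ∀ e, e ∈ E ↔ e ∈ H.edgeSet := fun e => by simp [E]
  let light : Finset (Sym2 V) := E.filter fun e => w e < M / n
  let heavy : Finset (Sym2 V) := E.filter fun e => M / n ≤ w e ∧ e ∉ T.edgeSet
  -- Only an inequality, since light tree edges are counted twice.
  have hsplit : ∑ e ∈ E, w e ≤ weight w T + ∑ e ∈ light, w e + ∑ e ∈ heavy, w e := by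
    have hT' : weight w T = ∑ e ∈ E, if e ∈ T.edgeSet then w e else 0 := by
      rw [weight_eq_sum_filter, Finset.sum_filter]
      symm
      refine Finset.sum_subset (Finset.subset_univ _) fun e _ he => if_neg fun h => he ?_
      exact (hE e).2 (SimpleGraph.edgeSet_mono hTH h)
    rw [hT', Finset.sum_filter _ (s := E), Finset.sum_filter _ (s := E), ← Finset.sum_add_distrib,
      ← Finset.sum_add_distrib]
    refine Finset.sum_le_sum fun e he => ?_
    have h0 := (hw e ((hE e).1 he)).le
    by_cases h1 : e ∈ T.edgeSet <;> by_cases h2 : w e < M / n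
    · simp only [h1, h2, if_true]; split_ifs <;> linarith
    · simp [h1, h2]
    · simp only [h1, h2, if_true, if_false]; split_ifs <;> linarith
    · simp [h1, h2, not_lt.1 h2]
  have hlight : ∑ e ∈ light, w e ≤ 2 * (n : ℝ) ^ (1 / (k : ℝ)) * M := by
    have h1 : ∑ e ∈ light, w e ≤ light.card • (M / n) :=
      Finset.sum_le_card_nsmul _ _ _ fun e he => (Finset.mem_filter.1 he).2.le
    have h2 := ncard_edgeSet_le_of_not_within hw hH (m := k) (by omega) (by nlinarith)
    have h3 : (light.card : ℝ) ≤ H.edgeSet.ncard := by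
      rw [← SimpleGraph.coe_edgeFinset, Set.ncard_coe_finset]
      exact_mod_cast Finset.card_le_card fun e he => by
        rw [SimpleGraph.mem_edgeFinset]
        exact (hE e).1 (Finset.mem_filter.1 he).1
    rw [nsmul_eq_mul] at h1
    refine h1.trans ((mul_le_mul_of_nonneg_right (h3.trans h2) (by positivity)).trans_eq ?_)
    rw [← hn, Real.rpow_add hn0', Real.rpow_one]
    field_simp
  have hlevel : ∀ e ∈ heavy, ∃ j : ℕ, M / n * k ^ j ≤ w e ∧ w e < M / n * k ^ (j + 1) := by
    intro e he
    have h1 : (1 : ℝ) ≤ w e / (M / n) := by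
      rw [one_le_div (by positivity)]; exact (Finset.mem_filter.1 he).2.1
    obtain ⟨j, h2, h3⟩ := exists_nat_pow_near h1 hk1
    refine ⟨j, ?_, ?_⟩
    · rwa [le_div_iff₀' (by positivity)] at h2
    · rwa [div_lt_iff₀' (by positivity)] at h3
  choose! lev hlev1 hlev2 using hlevel
  have hheavy : ∑ e ∈ heavy, w e ≤ 288 * (n : ℝ) ^ (1 / (k : ℝ)) *
      (k / (ε ^ (1 + 1 / (k : ℝ)) * Real.log k)) * M := by
    set J := heavy.sup lev + 1 with hJ
    rw [← Finset.sum_fiberwise_of_maps_to (t := Finset.range J) (g := lev) (fun e he => by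
      rw [Finset.mem_range, hJ, Nat.lt_succ_iff]; exact Finset.le_sup he)]
    have hbucket : ∀ j ∈ Finset.range J, ∑ e ∈ heavy with lev e = j, w e ≤
        144 * M * (n : ℝ) ^ (1 / (k : ℝ)) / ε ^ (1 + 1 / (k : ℝ)) *
          ((k : ℝ) ^ (-(1 / (k : ℝ)))) ^ j := by
      intro j _
      have hmem : ∀ e ∈ heavy.filter (lev · = j), e ∈ heavy ∧ lev e = j := fun e he =>
        Finset.mem_filter.1 he
      have hw₀ : 0 < M / n * (k : ℝ) ^ j := by positivity
      refine (sum_weight_le_of_not_within hk hε hw₀ hTH hT hTw hH ?_ ?_ ?_ ?_).trans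
        (le_trans ?_ (bucket_bound_le hk hn0 hε hM))
      · exact fun e he => (hE e).1 (Finset.mem_filter.1 (hmem e he).1).1
      · exact fun e he => (Finset.mem_filter.1 (hmem e he).1).2.2
      · intro e he
        obtain ⟨h1, rfl⟩ := hmem e he
        exact hlev1 e h1
      · intro e he
        obtain ⟨h1, rfl⟩ := hmem e he
        refine (hlev2 e h1).le.trans_eq ?_
        ring
      · have := weight_nonneg hTw
        gcongr
    refine (Finset.sum_le_sum hbucket).trans ?_
    rw [← Finset.mul_sum]
    refine (mul_le_mul_of_nonneg_left (geom_sum_rpow_le hk J) (by positivity)).trans_eq ?_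
    have : 0 < ε ^ (1 + 1 / (k : ℝ)) := by positivity
    field_simp
    norm_num
  have hfrac : 0 ≤ k / (ε ^ (1 + 1 / (k : ℝ)) * Real.log k) := by positivity
  rw [weight_eq_sum_filter]
  refine hsplit.trans ?_
  have h1 : M ≤ (n : ℝ) ^ (1 / (k : ℝ)) * M := le_mul_of_one_le_left hM.le hroot
  have h2 : 0 ≤ (n : ℝ) ^ (1 / (k : ℝ)) * M := by positivity
  linarith

/-- Since `t > 2k - 1`, its ceiling is at least `2k`; and `2m ≤ ⌈t⌉ < t + 1` is what the girth
argument requires. -/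
theorem two_mul_ceil_div_two {k : ℕ} {ε : ℝ} (hk : 1 ≤ k) (hε : 0 < ε) :
    k ≤ ⌈(2 * (k : ℝ) - 1) * (1 + ε)⌉₊ / 2 ∧
      2 * ((⌈(2 * (k : ℝ) - 1) * (1 + ε)⌉₊ / 2 : ℕ) : ℝ) ≤ (2 * (k : ℝ) - 1) * (1 + ε) + 1 := by
  have hk1 : (1 : ℝ) ≤ k := by exact_mod_cast hk
  have ht : 2 * (k : ℝ) - 1 < (2 * (k : ℝ) - 1) * (1 + ε) := by nlinarith
  constructor
  · have : 2 * k - 1 < ⌈(2 * (k : ℝ) - 1) * (1 + ε)⌉₊ := by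
      rw [Nat.lt_ceil, Nat.cast_sub (by omega)]
      push_cast
      exact ht
    omega
  · have h1 : 2 * (⌈(2 * (k : ℝ) - 1) * (1 + ε)⌉₊ / 2) ≤ ⌈(2 * (k : ℝ) - 1) * (1 + ε)⌉₊ :=
      Nat.mul_div_le _ _
    have h2 : 2 * ((⌈(2 * (k : ℝ) - 1) * (1 + ε)⌉₊ / 2 : ℕ) : ℝ) ≤
        ⌈(2 * (k : ℝ) - 1) * (1 + ε)⌉₊ := by exact_mod_cast h1
    linarith [Nat.ceil_lt_add_one (by nlinarith : 0 ≤ (2 * (k : ℝ) - 1) * (1 + ε))]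

end LightSpanner

theorem theorem1 :
    ∃ C : ℝ, 0 < C ∧
      ∀ (V : Type*) [Fintype V] (G : SimpleGraph V) (w : Sym2 V → ℝ) (k : ℕ) (ε : ℝ)
        (l : List (Sym2 V)),
        G.Connected → (∀ e ∈ G.edgeSet, 0 < w e) → 1 ≤ k → 0 < ε →
        LightSpanner.IsEdgeOrder G w l →
        LightSpanner.IsSpanner G w ((2 * k - 1) * (1 + ε))
            (LightSpanner.greedy w ((2 * k - 1) * (1 + ε)) l) ∧
        ((LightSpanner.greedy w ((2 * k - 1) * (1 + ε)) l).edgeSet.ncard : ℝ) ≤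
            C * (Fintype.card V : ℝ) ^ (1 + 1 / (k : ℝ)) ∧
        ((LightSpanner.greedy w ((2 * k - 1) * (1 + ε)) l).edgeSet.ncard : ℝ) ≤
            C * (Fintype.card V : ℝ) ^
              (1 + 1 / ((⌈(2 * (k : ℝ) - 1) * (1 + ε)⌉₊ / 2 : ℕ) : ℝ)) ∧
        (2 ≤ k → ∀ Z : SimpleGraph V, LightSpanner.IsMST G w Z →
          LightSpanner.lightness w (LightSpanner.greedy w ((2 * k - 1) * (1 + ε)) l) Z ≤
            C * ((Fintype.card V : ℝ) ^ (1 / (k : ℝ)) *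
              (1 + k / (ε ^ (1 + 1 / (k : ℝ)) * Real.log k)))) := by
  refine ⟨288, by norm_num, fun V _ G w k ε l hG hw hk hε hl => ?_⟩
  obtain ⟨hnd, hmem, hpw⟩ := hl
  have hk1 : (1 : ℝ) ≤ k := by exact_mod_cast hk
  have ht : (1 : ℝ) ≤ (2 * k - 1) * (1 + ε) := by nlinarith
  have inv := LightSpanner.greedyInvariant ht l hnd hpw (fun e he => hw e ((hmem e).1 he))
    fun e he => G.not_isDiag_of_mem_edgeSet ((hmem e).1 he)
  set H := LightSpanner.greedy w ((2 * k - 1) * (1 + ε)) l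
  have hspan := inv.isSpanner (by linarith) hmem fun e he => (hw e he).le
  have hHw : ∀ e ∈ H.edgeSet, 0 < w e := fun e he =>
    hw e (SimpleGraph.edgeSet_mono hspan.1 he)
  obtain ⟨hkm, hmt⟩ := LightSpanner.two_mul_ceil_div_two hk hε
  set m := ⌈(2 * (k : ℝ) - 1) * (1 + ε)⌉₊ / 2
  have := hG.nonempty
  have hn1 : (1 : ℝ) ≤ Fintype.card V := by exact_mod_cast Fintype.card_pos
  have hcard := LightSpanner.ncard_edgeSet_le_of_not_within hHw inv.not_within
    (by omega : m ≠ 0) hmt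
  have hcard' : (H.edgeSet.ncard : ℝ) ≤ 288 * (Fintype.card V : ℝ) ^ (1 + 1 / (m : ℝ)) :=
    hcard.trans (mul_le_mul_of_nonneg_right (by norm_num) (by positivity))
  refine ⟨hspan, hcard'.trans ?_, hcard', fun hk2 Z hZ => ?_⟩
  · have hkm' : (k : ℝ) ≤ m := by exact_mod_cast hkm
    have hexp : 1 + 1 / (m : ℝ) ≤ 1 + 1 / (k : ℝ) := by
      have := one_div_le_one_div_of_le (by linarith) hkm'
      linarith
    exact mul_le_mul_of_nonneg_left (Real.rpow_le_rpow_of_exponent_le hn1 hexp) (by norm_num)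
  · have hlog : 0 < Real.log k := Real.log_pos (by exact_mod_cast (by omega : 1 < k))
    obtain ⟨T, hTH, hT, hTZ⟩ := LightSpanner.exists_isTree_le_weight_le
      (fun x y hxy => inv.exists_walk x y ((hmem _).2 hxy)) hspan.1 hZ.1 hZ.2.1
    have hZ0 : 0 ≤ LightSpanner.weight w Z := LightSpanner.weight_nonneg fun e he =>
      (hw e (SimpleGraph.edgeSet_mono hZ.1 he)).le
    unfold LightSpanner.lightness
    rcases hZ0.eq_or_lt with h0 | h0
    -- A minimum spanning tree of weight zero, as for `n = 1`: the quotient is 0 by convention.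
    · rw [← h0, div_zero]; positivity
    · rw [div_le_iff₀ h0]
      exact LightSpanner.weight_le_of_not_within hk2 hε hTH hT.connected hHw inv.not_within h0 hTZ
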